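/- **Setting.** There are $N\ge1$ clients with $n$ observations each. Client $i$ observes $y_i^{(m)}=f_i(x_i^{(m)})+\varepsilon_i^{(m)}\in\mathbb R^{K}$, $m=1,\dots,n$, with $x_i^{(m)}\sim\mu_i$ and $\varepsilon_i^{(m)}\sim\mathcal N(0,\sigma_\varepsilon^2 I)$, $\sigma_\varepsilon>0$, all independent within the client; $f_i$ is measurable. The covariate laws $\mu_i$ are carried by a common domain $S\subset[-R,R]^{s_0}$, $s_0\ge1$. The backbone is a fully connected network $$f_w(x)=W_L\,\sigma(W_{L-1}\sigma(\cdots\sigma(W_0x+b_0)\cdots)+b_{L-1})+b_L$$ with $L\ge1$ hidden layers of equal width $M\ge2$, a $1$-Lipschitz activation $\sigma$ and $d$ parameters, which are confined to $\mathbb W=\{w\in\mathbb R^d:\|w\|_\infty\le B\}$, $B>0$. Assume $d\le s_0^2n$. For a mean $m\in\mathbb R^d$ and a vector of variances $v\in[0,\infty)^d$ let $\mathcal N_{\mathbb W}(m,v)$ be the Gaussian law $\mathcal N(m,\operatorname{diag}v)$ conditioned on $\mathbb W$ (variance $0$ means a point mass). The prior is $p(\cdot|\theta)=\mathcal N_{\mathbb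 W}(\theta)$ with $\theta\in\Theta$, the variational posterior of client $i$ is $q(\cdot|\phi_i)=\mathcal N_{\mathbb W}(\phi_i)$ with $\phi_i\in\Phi$. Here $\Theta,\Phi$ are any sets of parameters $(m,v)$ for which $\mathcal N(m,\operatorname{diag} v)$ gives $\mathbb W$ positive mass and which contain all $(m,(\tau,\dots,\tau))$ with $m\in\mathbb W$, $0<\tau\le B^2$ (for instance, all means and all positive variances). With $p(\mathcal D_i|w)=\prod_{m}\mathcal N(y_i^{(m)};f_w(x_i^{(m)}),\sigma_\varepsilon^2I)$, let $(\theta^\star,\phi_1^\star,\dots,\phi_N^\star)$ be any optimal solution of the negative Fed-ELBO problem $$\min_{\theta\in\Theta}\ \frac1N\sum_{i=1}^N\ \min_{\phi_i\in\Phi}\Big\{\mathbb E_{q(w|\phi_i)}[-\log p(\mathcal D_i|w)]+\mathrm{KL}\big(q(\cdot|\phi_i)\,\|\,p(\cdot|\theta)\big)\Big\},$$ and put $q_i^\star=q(\cdot|\phi_i^\star)$. Let $$d^2(P_w,P_i)=\mathbb E_{x\sim\mu_i}\Big[1-\exp\Big(-\frac{\|f_w(x)-f_i(x)\|_2^2}{8\sigma_\varepsilon^2}\Big)\Big],\qquad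 \xi_i=\inf_{w\in\mathbb W}\ \sup_{x\in S}\|f_w(x)-f_i(x)\|_2^2\in[0,\infty],$$ $$r_n=\frac{(L+1)d}{n}\log M+\frac dn\log\Big(s_0\sqrt{n/d}\Big),\qquad \epsilon_n=\sqrt{r_n}\,\log^{\delta}n,\qquad \delta>1.$$ **Theorem.** There are constants $C,C',C''>0$, depending only on $\sigma,B,\sigma_\varepsilon,\delta,R$, such that with high probability every optimal solution of the negative Fed-ELBO problem satisfies $$\frac1N\sum_{i=1}^N\mathbb E_{w\sim q_i^\star}\big[d^2(P_w,P_i)\big]\ \le\ C\,\epsilon_n^2+C'\,r_n+C''\,\frac1N\sum_{i=1}^N\xi_i .$$ "With high probability" means: for every $\eta>0$ there is $n_0$, depending only on $\eta,\sigma,B,\sigma_\varepsilon,\delta,R$, such that for all $n\ge n_0$, and all $N,s_0,M,L,K,S,\mu_i,f_i,\Theta,\Phi$ as above, this fails with (outer) probability at most $\eta$. -/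

import Mathlib

open MeasureTheory ProbabilityTheory
open scoped NNReal ENNReal

namespace FedELBO

/-! ### Fully connected networks of equal width -/

/-- Indices of the weights and biases of a network with input dimension `s₀`, `L ≥ 1` hidden layers
of width `M` and output dimension `K`: the input layer, the `L - 1` inner layers, the output
layer. In each layer `(j, some k)` is the matrix entry in row `j`, column `k`, and `(j, none)` is
the `j`-th bias. -/
abbrev WeightIndex (s₀ M L K : ℕ) : Type :=
  (Fin M × Option (Fin s₀)) ⊕ (Fin (L - 1) × Fin M × Option (Fin M)) ⊕ (Fin K × Option (Fin M))

/-- The number `d` of parameters. -/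
def numParams (s₀ M L K : ℕ) : ℕ := Fintype.card (WeightIndex s₀ M L K)

/-- The affine map `x ↦ W x + b`. -/
def affine {p q : ℕ} (A : Fin q × Option (Fin p) → ℝ) (x : Fin p → ℝ) : Fin q → ℝ :=
  fun j => (∑ k, A (j, some k) * x k) + A (j, none)

/-- `x ↦ W_L σ(W_{L-1} σ(⋯ σ(W_0 x + b_0) ⋯) + b_{L-1}) + b_L`, with `σ` acting entrywise. -/
def network {s₀ M L K : ℕ} (σ : ℝ → ℝ) (w : WeightIndex s₀ M L K → ℝ) (x : Fin s₀ → ℝ) :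
    Fin K → ℝ :=
  affine (fun a => w (.inr (.inr a)))
    (Fin.foldl (L - 1) (fun h l j => σ (affine (fun a => w (.inr (.inl (l, a)))) h j))
      (fun j => σ (affine (fun a => w (.inl a)) x j)))

/-- The bounded weight space `{w : ‖w‖_∞ ≤ B}`. -/
def weightBox (ι : Type) (B : ℝ) : Set (ι → ℝ) := {w | ∀ j, |w j| ≤ B}

/-! ### The regression model -/

/-- The squared Euclidean distance. -/
def sqDist {K : ℕ} (u v : Fin K → ℝ) : ℝ := ∑ k, (u k - v k) ^ 2

/-- A data set: `n` pairs (covariate, response). -/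
abbrev Dataset (s₀ K n : ℕ) : Type := Fin n → (Fin s₀ → ℝ) × (Fin K → ℝ)

/-- The law of `(x, f x + ε)` with `x ∼ μ` and `ε ∼ N(0, s² I)` independent. -/
noncomputable def regressionLaw {s₀ K : ℕ} (μ : Measure (Fin s₀ → ℝ))
    (f : (Fin s₀ → ℝ) → Fin K → ℝ) (s : ℝ≥0) : Measure ((Fin s₀ → ℝ) × (Fin K → ℝ)) :=
  (μ.prod (Measure.pi fun _ : Fin K => gaussianReal 0 (s ^ 2))).map fun z => (z.1, f z.1 + z.2)

/-- The law of `n` independent observations. -/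
noncomputable def dataLaw {s₀ K : ℕ} (n : ℕ) (μ : Measure (Fin s₀ → ℝ))
    (f : (Fin s₀ → ℝ) → Fin K → ℝ) (s : ℝ≥0) : Measure (Dataset s₀ K n) :=
  Measure.pi fun _ => regressionLaw μ f s

/-- The negative log-likelihood `-log p(D | w)` when the responses given the covariates are
independent `N(g x, s² I)`. -/
noncomputable def negLogLik {s₀ K n : ℕ} (s : ℝ≥0) (g : (Fin s₀ → ℝ) → Fin K → ℝ)
    (D : Dataset s₀ K n) : ℝ :=
  -Real.log (∏ m, ∏ k, gaussianPDFReal (g (D m).1 k) (s ^ 2) ((D m).2 k))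

/-- The squared Hellinger distance between the regression models with regression functions `g` and
`f`, covariate law `μ` and noise `N(0, s² I)`. -/
noncomputable def hellingerSq {s₀ K : ℕ} (s : ℝ≥0) (μ : Measure (Fin s₀ → ℝ))
    (g f : (Fin s₀ → ℝ) → Fin K → ℝ) : ℝ :=
  ∫ x, (1 - Real.exp (-sqDist (g x) (f x) / (8 * (s : ℝ) ^ 2))) ∂μ

/-- The best squared sup-norm approximation error of `f` on the covariate domain `S` by networks
with weights bounded by `B` (possibly infinite). -/
noncomputable def approxError {s₀ K : ℕ} (M L : ℕ) (σ : ℝ → ℝ) (B : ℝ) (S : Set (Fin s₀ → ℝ))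
    (f : (Fin s₀ → ℝ) → Fin K → ℝ) : ℝ≥0∞ :=
  ⨅ w ∈ weightBox (WeightIndex s₀ M L K) B,
    ⨆ x ∈ S, ENNReal.ofReal (sqDist (network σ w x) (f x))

/-! ### Priors, variational posteriors and the negative Fed-ELBO -/

/-- Means and variances of the weights. -/
abbrev GaussParam (ι : Type) : Type := (ι → ℝ) × (ι → ℝ≥0)

/-- The Gaussian `N(m, diag v)`. A variance `0` gives a point mass in that coordinate. -/
noncomputable def diagGaussian {ι : Type} [Fintype ι] (a : GaussParam ι) : Measure (ι → ℝ) :=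
  Measure.pi fun j => gaussianReal (a.1 j) (a.2 j)

/-- The Gaussian `N(m, diag v)` for weights that are confined to the box `‖w‖_∞ ≤ B`. -/
noncomputable def weightLaw {ι : Type} [Fintype ι] (B : ℝ) (a : GaussParam ι) :
    Measure (ι → ℝ) :=
  ProbabilityTheory.cond (diagGaussian a) (weightBox ι B)

/-- Sets of parameters that may be optimized over: every Gaussian charges the box (always the case
if the variances are positive), and all isotropic Gaussians with mean in the box and standard
deviation at most `B` are available. -/
structure IsParamSet {ι : Type} [Fintype ι] (B : ℝ) (A : Set (GaussParam ι)) : Prop where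
  charges : ∀ a ∈ A, diagGaussian a (weightBox ι B) ≠ 0
  isotropic_mem : ∀ m ∈ weightBox ι B, ∀ v : ℝ≥0, 0 < v → (v : ℝ) ≤ B ^ 2 →
    ((m, fun _ => v) : GaussParam ι) ∈ A

/-- The local negative ELBO `E_{q(w|φ)}[-log p(D | w)] + KL(q(·|φ) ‖ p(·|θ))`. -/
noncomputable def localObjective {s₀ M L K n : ℕ} (σ : ℝ → ℝ) (B : ℝ) (s : ℝ≥0)
    (D : Dataset s₀ K n) (θ φ : GaussParam (WeightIndex s₀ M L K)) : EReal :=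
  ((∫ w, negLogLik s (network σ w) D ∂(weightLaw B φ) : ℝ) : EReal) +
    ((InformationTheory.klDiv (weightLaw B φ) (weightLaw B θ) : ℝ≥0∞) : EReal)

/-- The outer objective `F(θ) = (1/N) ∑ i, min_φ (local negative ELBO of client i)`. -/
noncomputable def fedObjective {s₀ M L K n N : ℕ} (σ : ℝ → ℝ) (B : ℝ) (s : ℝ≥0)
    (Φ : Set (GaussParam (WeightIndex s₀ M L K))) (D : Fin N → Dataset s₀ K n)
    (θ : GaussParam (WeightIndex s₀ M L K)) : EReal :=
  (((N : ℝ)⁻¹ : ℝ) : EReal) * ∑ i, ⨅ φ ∈ Φ, localObjective σ B s (D i) θ φ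

/-- `(θ, φ₁, …, φ_N)` solves the bi-level problem: `θ` minimizes the outer objective over `Θ`, and
each `φ i` minimizes the local objective of client `i` at `θ` over `Φ`. -/
def IsOptimal {s₀ M L K n N : ℕ} (σ : ℝ → ℝ) (B : ℝ) (s : ℝ≥0)
    (Θ Φ : Set (GaussParam (WeightIndex s₀ M L K))) (D : Fin N → Dataset s₀ K n)
    (θ : GaussParam (WeightIndex s₀ M L K))
    (φ : Fin N → GaussParam (WeightIndex s₀ M L K)) : Prop :=
  (θ ∈ Θ ∧ ∀ θ' ∈ Θ, fedObjective σ B s Φ D θ ≤ fedObjective σ B s Φ D θ') ∧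
    ∀ i, φ i ∈ Φ ∧
      ∀ φ' ∈ Φ, localObjective σ B s (D i) θ (φ i) ≤ localObjective σ B s (D i) θ φ'

/-! ### The rates -/

/-- `r_n = ((L+1)d/n) log M + (d/n) log (s₀ √(n/d))`. -/
noncomputable def rate (s₀ M L K n : ℕ) : ℝ :=
  let d : ℝ := numParams s₀ M L K
  ((L + 1) * d / n) * Real.log M + (d / n) * Real.log (s₀ * √(n / d))

/-- `ε_n = √r_n · (log n)^δ`. -/
noncomputable def epsRate (δ : ℝ) (s₀ M L K n : ℕ) : ℝ :=
  √(rate s₀ M L K n) * Real.log n ^ δ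

end FedELBO

/-!
The argument compares the optimal posteriors with narrow Gaussians around nearly best approximating
weights, and converts small expected losses into small Hellinger distances by a deviation bound that
is uniform over the whole weight box. The uniformity is what makes a data-dependent prior harmless:
the divergence of the optimal posteriors is only used to be nonnegative.

*Deviations.* The excess loss `excessLoss` of a network over the true regression function is minus
the log-likelihood ratio. Its exponential with exponent `-1/2` has as expectation the `n`-th power of
the Hellinger affinity (`lintegral_exp_neg_half_excessLoss_le`), so that for one weight vector
`n d² ≤ loss / 2 + O(1)` in an integrated sense. A network is Lipschitz in its weights
(`sqDist_network_le`), with a constant `K (G M) ^ L G s₀` in which `G` depends on `σ`, `B` and `R` only.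
A union bound over a grid of `T ^ d` points, with `T` polynomial in `n` and in this constant, extends the
inequality to all weights at the price of `d log T` (`uniform_deviation`). The true regression function
need not be bounded, but it is within the approximation error of some network. The excess
loss of that network exceeds twice its mean given the covariates by `O(1)` only
(`lintegral_exp_excessLoss`), so the approximation errors enter with a constant free of `η`.

*Comparison.* The prior `N(0, B² I)` and the posteriors `N(w₀, (B / T)² I)`, all conditioned on the
box, are admissible. Conditioned product Gaussians are products of conditioned Gaussians
(`weightLaw_eq_pi`), the posteriors have density at most `(10 T) ^ d` with respect to the prior, and
so their divergence is at most `d log (10 T) + 1` (`klDiv_weightLaw_le`). Their expected excess loss is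
of the order of `n` times the approximation error, plus `O(d)` (`integral_excessLoss_le`). Optimality
(`IsOptimal.sum_integral_le`) carries this over to the optimal posteriors.

*Rates.* Since `d²` is at most one, only `r_n < 1` matters, and then the number of parameters is at most
`n`. This makes `d log T` of order `n r_n log n` (`mul_log_resolution_le`). All randomness is collected
in one nonnegative variable per client, with expectation of order `n r_n`
(`exists_deviation_bound`); Markov's inequality for their average needs no independence between the
clients, and its factor `1 / η`, like the factor `log n`, is absorbed by `log ^ (2 δ) n`.
-/

namespace FedELBO

/-! ### Networks as functions of their weights -/

/-- Induction along two folds that run in parallel. -/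
lemma foldl_rel {α β : Type*} (n : ℕ) (Q : ℕ → α → β → Prop) (f : α → Fin n → α)
    (g : β → Fin n → β) (x : α) (y : β) (h0 : Q 0 x y)
    (hs : ∀ (i : Fin n) a b, Q i a b → Q (i + 1) (f a i) (g b i)) :
    Q n (Fin.foldl n f x) (Fin.foldl n g y) := by
  induction n with
  | zero => simpa using h0
  | succ n ih =>
    rw [Fin.foldl_succ_last, Fin.foldl_succ_last]
    exact hs (Fin.last n) _ _ (ih _ _ fun i a b h => hs i.castSucc a b h)

lemma continuous_foldl {Z α : Type*} [TopologicalSpace Z] [TopologicalSpace α] (n : ℕ)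
    (f : Z → α → Fin n → α) (x : Z → α) (hx : Continuous x)
    (hf : ∀ i, Continuous fun p : Z × α => f p.1 p.2 i) :
    Continuous fun z => Fin.foldl n (f z) (x z) := by
  induction n with
  | zero => simpa using hx
  | succ n ih =>
    simp only [Fin.foldl_succ_last]
    exact (hf (Fin.last n)).comp
      (continuous_id.prodMk (ih (fun z a i => f z a i.castSucc) fun i => hf i.castSucc))

lemma continuous_network {s₀ M L K : ℕ} {σ : ℝ → ℝ} (hσ : Continuous σ) :
    Continuous fun p : (WeightIndex s₀ M L K → ℝ) × (Fin s₀ → ℝ) => network σ p.1 p.2 := by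
  have haff : ∀ {Z : Type} [TopologicalSpace Z] {p q : ℕ} {A : Z → Fin q × Option (Fin p) → ℝ}
      {x : Z → Fin p → ℝ}, Continuous A → Continuous x → Continuous fun z => affine (A z) (x z) := by
    intro Z _ p q A x hA hx
    unfold affine
    fun_prop
  unfold network
  refine haff (by fun_prop) ?_
  refine continuous_foldl _ (fun (p : (WeightIndex s₀ M L K → ℝ) × (Fin s₀ → ℝ)) h l j =>
    σ (affine (fun a => p.1 (.inr (.inl (l, a)))) h j)) _ ?_ fun i => ?_
  · have h : Continuous fun p : (WeightIndex s₀ M L K → ℝ) × (Fin s₀ → ℝ) =>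
        affine (fun a => p.1 (.inl a)) p.2 := haff (by fun_prop) (by fun_prop)
    exact continuous_pi fun j => hσ.comp ((continuous_apply j).comp h)
  · have h : Continuous fun q : ((WeightIndex s₀ M L K → ℝ) × (Fin s₀ → ℝ)) × (Fin M → ℝ) =>
        affine (fun a => q.1.1 (.inr (.inl (i, a)))) q.2 := haff (by fun_prop) (by fun_prop)
    exact continuous_pi fun j => hσ.comp ((continuous_apply j).comp h)

lemma abs_affine_le {p q : ℕ} {A : Fin q × Option (Fin p) → ℝ} {x : Fin p → ℝ} {B X : ℝ}
    (hA : ∀ a, |A a| ≤ B) (hx : ∀ k, |x k| ≤ X) (hB : 0 ≤ B) (j : Fin q) :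
    |affine A x j| ≤ p * (B * X) + B := by
  refine (abs_add_le _ _).trans (add_le_add ?_ (hA _))
  refine (Finset.abs_sum_le_sum_abs _ _).trans ?_
  refine (Finset.sum_le_card_nsmul _ _ (B * X) fun k _ => ?_).trans (by simp)
  rw [abs_mul]
  exact mul_le_mul (hA _) (hx k) (abs_nonneg _) hB

lemma abs_affine_sub_le {p q : ℕ} {A A' : Fin q × Option (Fin p) → ℝ} {x x' : Fin p → ℝ}
    {B X r ρ : ℝ} (hA : ∀ a, |A a| ≤ B) (hx' : ∀ k, |x' k| ≤ X) (hB : 0 ≤ B) (hr : 0 ≤ r)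
    (hAA : ∀ a, |A a - A' a| ≤ r) (hxx : ∀ k, |x k - x' k| ≤ ρ) (j : Fin q) :
    |affine A x j - affine A' x' j| ≤ p * (B * ρ + r * X) + r := by
  have e : affine A x j - affine A' x' j =
      (∑ k, (A (j, some k) * (x k - x' k) + (A (j, some k) - A' (j, some k)) * x' k)) +
        (A (j, none) - A' (j, none)) := by
    simp only [affine, Finset.sum_add_distrib, mul_sub, sub_mul, Finset.sum_sub_distrib]
    ring
  rw [e]
  refine (abs_add_le _ _).trans (add_le_add ?_ (hAA _))
  refine (Finset.abs_sum_le_sum_abs _ _).trans ?_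
  refine (Finset.sum_le_card_nsmul _ _ (B * ρ + r * X) fun k _ => ?_).trans (by simp [mul_add])
  refine (abs_add_le _ _).trans ?_
  rw [abs_mul, abs_mul]
  exact add_le_add (mul_le_mul (hA _) (hxx k) (abs_nonneg _) hB)
    (mul_le_mul (hAA _) (hx' k) (abs_nonneg _) hr)

/-- The growth factor of a layer of a network, per unit of width. -/
noncomputable def layerGrowth (σ : ℝ → ℝ) (B R : ℝ) : ℝ := |σ 0| + 2 * B + B * |R| + |R| + 2

/-- A Lipschitz constant of `w ↦ network σ w x`, from the sup-norm on the box to the Euclidean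
norm, valid for all `x` in the cube of half-width `R`. -/
noncomputable def networkLip (σ : ℝ → ℝ) (B R : ℝ) (s₀ M L K : ℕ) : ℝ :=
  K * ((layerGrowth σ B R * M) ^ L * (layerGrowth σ B R * s₀))

lemma one_le_layerGrowth (σ : ℝ → ℝ) {B : ℝ} (hB : 0 < B) (R : ℝ) : 1 ≤ layerGrowth σ B R := by
  unfold layerGrowth
  have := abs_nonneg (σ 0)
  have := abs_nonneg R
  have := mul_nonneg hB.le (abs_nonneg R)
  linarith

lemma one_le_networkLip (σ : ℝ → ℝ) {B : ℝ} (hB : 0 < B) (R : ℝ) {s₀ M L K : ℕ} (hs₀ : 1 ≤ s₀)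
    (hM : 1 ≤ M) (hK : 1 ≤ K) : 1 ≤ networkLip σ B R s₀ M L K := by
  have hG := one_le_layerGrowth σ hB R
  have h1 : (1 : ℝ) ≤ s₀ := by exact_mod_cast hs₀
  have h2 : (1 : ℝ) ≤ M := by exact_mod_cast hM
  have h3 : (1 : ℝ) ≤ K := by exact_mod_cast hK
  unfold networkLip
  exact one_le_mul_of_one_le_of_one_le h3 (one_le_mul_of_one_le_of_one_le
    (one_le_pow₀ (one_le_mul_of_one_le_of_one_le hG h2)) (one_le_mul_of_one_le_of_one_le hG h1))

/-- Bounded weights make the hidden layers grow by at most a factor `layerGrowth * M` each, and a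
perturbation of the weights by `r` makes the layers differ by at most `r` times the bound for their
size; both bounds propagate together through the layers. -/
lemma sqDist_network_le {s₀ M L K : ℕ} {σ : ℝ → ℝ} (hσ : LipschitzWith 1 σ) {B R r : ℝ}
    (hB : 0 < B) (hr : 0 ≤ r) (hs₀ : 1 ≤ s₀) (hM : 1 ≤ M) (hL : 1 ≤ L)
    {w w' : WeightIndex s₀ M L K → ℝ} (hw : w ∈ weightBox _ B) (hw' : w' ∈ weightBox _ B)
    (hd : ∀ j, |w j - w' j| ≤ r) {x : Fin s₀ → ℝ} (hx : ∀ k, |x k| ≤ R) :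
    sqDist (network σ w x) (network σ w' x) ≤ networkLip σ B R s₀ M L K ^ 2 * r ^ 2 := by
  set G := layerGrowth σ B R with hGdef
  have hG1 : 1 ≤ G := one_le_layerGrowth σ hB R
  have hR0 := abs_nonneg R
  have hσ0 := abs_nonneg (σ 0)
  have hBR := mul_nonneg hB.le hR0
  have h1 : (1 : ℝ) ≤ s₀ := by exact_mod_cast hs₀
  have h2 : (1 : ℝ) ≤ M := by exact_mod_cast hM
  have hxR : ∀ k, |x k| ≤ |R| := fun k => (hx k).trans (le_abs_self R)
  have hsub : ∀ u v, |σ u - σ v| ≤ |u - v| := fun u v => by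
    simpa [Real.dist_eq] using hσ.dist_le_mul u v
  have habs : ∀ u, |σ u| ≤ |σ 0| + |u| := fun u => by
    have := hsub u 0
    rw [sub_zero] at this
    have := abs_sub_abs_le_abs_sub (σ u) (σ 0)
    linarith
  have hA1 : ∀ l : ℕ, 1 ≤ (G * M) ^ l * (G * s₀) := fun l =>
    one_le_mul_of_one_le_of_one_le (one_le_pow₀ (one_le_mul_of_one_le_of_one_le hG1 h2))
      (one_le_mul_of_one_le_of_one_le hG1 h1)
  -- one layer, applied to inputs of size `X`
  have hstep : ∀ X : ℝ, 1 ≤ X → M * (B * (X * r) + r * X) + r ≤ G * M * X * r := by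
    intro X hX
    have hMX : 1 ≤ M * X := one_le_mul_of_one_le_of_one_le h2 hX
    have : M * (B * (X * r) + r * X) + r ≤ (B + 2) * (M * X * r) := by
      have := mul_le_mul_of_nonneg_right hMX hr
      nlinarith
    refine this.trans ?_
    have h0 : 0 ≤ M * X * r := by positivity
    calc (B + 2) * (M * X * r) ≤ G * (M * X * r) :=
          mul_le_mul_of_nonneg_right (by rw [hGdef, layerGrowth]; linarith) h0
      _ = _ := by ring
  have hsize : ∀ X : ℝ, 1 ≤ X → |σ 0| + (M * (B * X) + B) ≤ G * M * X := by
    intro X hX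
    have hMX : 1 ≤ M * X := one_le_mul_of_one_le_of_one_le h2 hX
    calc |σ 0| + (M * (B * X) + B) ≤ (|σ 0| + 2 * B) * (M * X) := by nlinarith
      _ ≤ G * (M * X) :=
          mul_le_mul_of_nonneg_right (by rw [hGdef, layerGrowth]; linarith) (by linarith)
      _ = _ := by ring
  have key := foldl_rel (L - 1)
    (fun l (h h' : Fin M → ℝ) => (∀ j, |h j| ≤ (G * M) ^ l * (G * s₀)) ∧
      (∀ j, |h' j| ≤ (G * M) ^ l * (G * s₀)) ∧
      ∀ j, |h j - h' j| ≤ (G * M) ^ l * (G * s₀) * r)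
    (fun h l j => σ (affine (fun a => w (.inr (.inl (l, a)))) h j))
    (fun h l j => σ (affine (fun a => w' (.inr (.inl (l, a)))) h j))
    (fun j => σ (affine (fun a => w (.inl a)) x j))
    (fun j => σ (affine (fun a => w' (.inl a)) x j)) ?_ ?_
  · obtain ⟨-, hb, hc⟩ := key
    have hcoord : ∀ k, |network σ w x k - network σ w' x k| ≤
        (G * M) ^ L * (G * s₀) * r := by
      intro k
      refine (abs_affine_sub_le (fun a => hw _) hb hB.le hr (fun a => hd _) hc k).trans ?_
      refine (hstep _ (hA1 _)).trans (le_of_eq ?_)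
      obtain ⟨l, rfl⟩ : ∃ l, L = l + 1 := ⟨L - 1, by omega⟩
      simp only [Nat.add_sub_cancel, pow_succ]
      ring
    have hK : (K : ℝ) ≤ K ^ 2 := by
      exact_mod_cast Nat.le_self_pow (by norm_num) K
    calc sqDist (network σ w x) (network σ w' x)
        ≤ ∑ _k : Fin K, ((G * M) ^ L * (G * s₀) * r) ^ 2 :=
          Finset.sum_le_sum fun k _ => sq_le_sq' (abs_le.1 (hcoord k)).1 (abs_le.1 (hcoord k)).2
      _ = K * ((G * M) ^ L * (G * s₀) * r) ^ 2 := by simp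
      _ ≤ K ^ 2 * ((G * M) ^ L * (G * s₀) * r) ^ 2 := by gcongr
      _ = networkLip σ B R s₀ M L K ^ 2 * r ^ 2 := by rw [networkLip]; ring
  · have hfirst : |σ 0| + (s₀ * (B * |R|) + B) ≤ G * s₀ := by
      calc |σ 0| + (s₀ * (B * |R|) + B) ≤ (|σ 0| + B * |R| + B) * s₀ := by nlinarith
        _ ≤ G * s₀ :=
          mul_le_mul_of_nonneg_right (by rw [hGdef, layerGrowth]; linarith) (by linarith)
    refine ⟨fun j => ?_, fun j => ?_, fun j => ?_⟩
    · rw [pow_zero, one_mul]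
      exact (habs _).trans (le_trans (by gcongr; exact abs_affine_le (fun a => hw _) hxR hB.le j)
        hfirst)
    · rw [pow_zero, one_mul]
      exact (habs _).trans (le_trans (by gcongr; exact abs_affine_le (fun a => hw' _) hxR hB.le j)
        hfirst)
    · rw [pow_zero, one_mul]
      refine (hsub _ _).trans ((abs_affine_sub_le (ρ := 0) (fun a => hw _) hxR hB.le hr
        (fun a => hd _) (by simp) j).trans ?_)
      have : s₀ * (B * 0 + r * |R|) + r ≤ (|R| + 1) * s₀ * r := by nlinarith
      refine this.trans ?_
      gcongr
      rw [hGdef, layerGrowth]; linarith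
  · rintro i h h' ⟨ha, hb, hc⟩
    have he : (G * M) ^ ((i : ℕ) + 1) * (G * s₀) = G * M * ((G * M) ^ (i : ℕ) * (G * s₀)) := by
      rw [pow_succ]; ring
    refine ⟨fun j => ?_, fun j => ?_, fun j => ?_⟩
    · rw [he]
      exact (habs _).trans (le_trans (by gcongr; exact abs_affine_le (fun a => hw _) ha hB.le j)
        (hsize _ (hA1 _)))
    · rw [he]
      exact (habs _).trans (le_trans (by gcongr; exact abs_affine_le (fun a => hw' _) hb hB.le j)
        (hsize _ (hA1 _)))
    · rw [he]
      exact (hsub _ _).trans ((abs_affine_sub_le (fun a => hw _) hb hB.le hr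
        (fun a => hd _) hc j).trans (hstep _ (hA1 _)))

/-! ### Truncated Gaussians and their Kullback-Leibler divergence -/

lemma pi_le_smul_pi {ι : Type*} [Fintype ι] {α : ι → Type*} [∀ i, MeasurableSpace (α i)]
    {ν ν' : ∀ i, Measure (α i)} [∀ i, SigmaFinite (ν i)] [∀ i, SigmaFinite (ν' i)] {c : ℝ≥0}
    (hc : c ≠ 0) (h : ∀ i, ν i ≤ c • ν' i) :
    Measure.pi ν ≤ (c ^ Fintype.card ι) • Measure.pi ν' := by
  have hc' : c ^ Fintype.card ι ≠ 0 := pow_ne_zero _ hc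
  -- the product outer measure dominates every outer measure that is small on boxes
  have key : ((c ^ Fintype.card ι)⁻¹ • Measure.pi ν).toOuterMeasure ≤
      OuterMeasure.pi fun i => (ν' i).toOuterMeasure := by
    rw [OuterMeasure.le_pi]
    intro s _
    change ((c ^ Fintype.card ι)⁻¹ • Measure.pi ν) (Set.univ.pi s) ≤ ∏ i, ν' i (s i)
    rw [Measure.smul_apply, Measure.pi_pi, ENNReal.smul_def, smul_eq_mul,
      ENNReal.coe_inv hc', ← ENNReal.div_eq_inv_mul]
    refine ENNReal.div_le_of_le_mul' ?_
    calc ∏ i, ν i (s i) ≤ ∏ i, (c : ℝ≥0∞) * ν' i (s i) :=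
          Finset.prod_le_prod' fun i _ => h i (s i)
      _ = _ := by rw [Finset.prod_mul_distrib]; simp
  refine Measure.le_iff.2 fun s hs => ?_
  have h1 := key s
  have h2 : (OuterMeasure.pi fun i => (ν' i).toOuterMeasure) s = Measure.pi ν' s := by
    rw [Measure.pi, toMeasure_apply _ _ hs]
  rw [h2] at h1
  change ((c ^ Fintype.card ι)⁻¹ • Measure.pi ν) s ≤ _ at h1
  rw [Measure.smul_apply, ENNReal.smul_def, smul_eq_mul, ENNReal.coe_inv hc',
    ← ENNReal.div_eq_inv_mul] at h1
  rw [Measure.smul_apply, ENNReal.smul_def, smul_eq_mul]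
  refine (ENNReal.div_le_iff_le_mul (.inl (ENNReal.coe_ne_zero.2 hc')) (.inl ENNReal.coe_ne_top)).1 h1
    |>.trans_eq (mul_comm _ _)

/-- A bounded density bounds the divergence. The summand `1` is the price for estimating the integrand
`klFun`, which is nonnegative but not `x log x`, from above by `x log c + 1`. -/
lemma klDiv_le_of_le_smul {α : Type*} [MeasurableSpace α] {μ ν : Measure α}
    [IsProbabilityMeasure μ] [IsProbabilityMeasure ν] {c : ℝ≥0} (hc : 1 ≤ c) (h : μ ≤ c • ν) :
    InformationTheory.klDiv μ ν ≤ ENNReal.ofReal (Real.log c + 1) := by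
  have hac : μ ≪ ν := (Measure.absolutelyContinuous_of_le h).trans
    (Measure.smul_absolutelyContinuous)
  have hle : ∀ᵐ x ∂ν, μ.rnDeriv ν x ≤ c := by
    refine ae_le_of_forall_setLIntegral_le_of_sigmaFinite (Measure.measurable_rnDeriv _ _)
      fun s hs _ => ?_
    rw [lintegral_const, Measure.restrict_apply_univ]
    exact (Measure.setLIntegral_rnDeriv_le s).trans (h s)
  have hlog : 0 ≤ Real.log c := Real.log_nonneg (by exact_mod_cast hc)
  rw [InformationTheory.klDiv_eq_lintegral_klFun_of_ac hac]
  calc ∫⁻ x, ENNReal.ofReal (InformationTheory.klFun (μ.rnDeriv ν x).toReal) ∂ν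
      ≤ ∫⁻ x, (μ.rnDeriv ν x * ENNReal.ofReal (Real.log c) + 1) ∂ν := by
        refine lintegral_mono_ae ?_
        filter_upwards [hle] with x hx
        have hfin : μ.rnDeriv ν x ≠ ∞ := (hx.trans_lt ENNReal.coe_lt_top).ne
        set t := (μ.rnDeriv ν x).toReal with ht
        have ht0 : 0 ≤ t := ENNReal.toReal_nonneg
        have htc : t ≤ c := by
          have := ENNReal.toReal_mono ENNReal.coe_ne_top hx
          simpa using this
        have hx' : μ.rnDeriv ν x = ENNReal.ofReal t := (ENNReal.ofReal_toReal hfin).symm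
        rw [hx', ← ENNReal.ofReal_mul ht0, ← ENNReal.ofReal_one,
          ← ENNReal.ofReal_add (by positivity) zero_le_one]
        refine ENNReal.ofReal_le_ofReal ?_
        have : t * Real.log t ≤ t * Real.log c := by
          rcases ht0.eq_or_lt with h0 | h0
          · rw [← h0]; simp
          · exact mul_le_mul_of_nonneg_left (Real.log_le_log h0 htc) ht0
        simp only [InformationTheory.klFun]
        linarith
    _ = ENNReal.ofReal (Real.log c) + 1 := by
        rw [lintegral_add_right _ measurable_const, lintegral_mul_const _
          (Measure.measurable_rnDeriv _ _), Measure.lintegral_rnDeriv hac]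
        simp
    _ = ENNReal.ofReal (Real.log c + 1) := by
        rw [ENNReal.ofReal_add hlog zero_le_one, ENNReal.ofReal_one]

lemma weightBox_eq_pi (ι : Type) (B : ℝ) :
    weightBox ι B = Set.univ.pi fun _ => Set.Icc (-B) B := by
  ext w
  simp only [weightBox, Set.mem_ofPred_eq, Set.mem_pi, Set.mem_univ, true_imp_iff, Set.mem_Icc,
    abs_le]

lemma measurableSet_weightBox (ι : Type) [Countable ι] (B : ℝ) :
    MeasurableSet (weightBox ι B) := by
  rw [weightBox_eq_pi]
  exact MeasurableSet.univ_pi fun _ => measurableSet_Icc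

/-- Conditioning a product Gaussian on the box conditions its coordinates independently. -/
lemma weightLaw_eq_pi {ι : Type} [Fintype ι] (B : ℝ) (a : GaussParam ι)
    (h : ∀ j, gaussianReal (a.1 j) (a.2 j) (Set.Icc (-B) B) ≠ 0) :
    weightLaw B a =
      Measure.pi fun j => ProbabilityTheory.cond (gaussianReal (a.1 j) (a.2 j))
        (Set.Icc (-B) B) := by
  have : ∀ j, IsProbabilityMeasure (ProbabilityTheory.cond (gaussianReal (a.1 j) (a.2 j))
    (Set.Icc (-B) B)) := fun j => cond_isProbabilityMeasure (h j)
  refine (Measure.pi_eq fun s hs => ?_).symm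
  rw [weightLaw, diagGaussian, cond_apply (measurableSet_weightBox ι B), weightBox_eq_pi,
    ← Set.pi_inter_distrib, Measure.pi_pi, Measure.pi_pi]
  simp_rw [cond_apply measurableSet_Icc]
  rw [Finset.prod_mul_distrib, ENNReal.prod_inv_distrib]
  intro i _ j _ _
  exact Or.inr (measure_ne_top _ _)

lemma isProbabilityMeasure_weightLaw {ι : Type} [Fintype ι] {B : ℝ} {a : GaussParam ι}
    (h : diagGaussian a (weightBox ι B) ≠ 0) : IsProbabilityMeasure (weightLaw B a) := by
  have : IsProbabilityMeasure (diagGaussian a) := by unfold diagGaussian; infer_instance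
  exact cond_isProbabilityMeasure h

lemma ae_weightLaw_mem {ι : Type} [Fintype ι] (B : ℝ) (a : GaussParam ι) :
    ∀ᵐ w ∂weightLaw B a, w ∈ weightBox ι B :=
  ae_cond_mem (measurableSet_weightBox ι B)

/-- A Gaussian centred in `[-B, B]` with standard deviation `t ≤ B` charges a one-sided interval of
length `t` next to its mean that stays inside `[-B, B]`. -/
lemma gaussianReal_Icc_ge {B m t : ℝ} (ht : 0 < t) (htB : t ≤ B) (hm : |m| ≤ B) :
    ENNReal.ofReal (1 / 5) ≤ gaussianReal m (Real.toNNReal t ^ 2) (Set.Icc (-B) B) := by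
  have hv : (Real.toNNReal t ^ 2 : ℝ≥0) ≠ 0 := by simpa using ht
  have hv' : ((Real.toNNReal t ^ 2 : ℝ≥0) : ℝ) = t ^ 2 := by
    simp [Real.coe_toNNReal _ ht.le]
  obtain ⟨u, hu, hum⟩ : ∃ u, Set.Icc u (u + t) ⊆ Set.Icc (-B) B ∧
      ∀ x ∈ Set.Icc u (u + t), |x - m| ≤ t := by
    rw [abs_le] at hm
    rcases le_total 0 m with h0 | h0
    · refine ⟨m - t, Set.Icc_subset_Icc (by linarith) (by linarith), fun x hx => ?_⟩
      rw [abs_le]; constructor <;> linarith [hx.1, hx.2]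
    · refine ⟨m, Set.Icc_subset_Icc (by linarith) (by linarith), fun x hx => ?_⟩
      rw [abs_le]; constructor <;> linarith [hx.1, hx.2]
  refine le_trans ?_ (measure_mono hu)
  rw [gaussianReal_apply _ hv]
  have hpi : √(2 * Real.pi * t ^ 2) ≤ 3 * t := by
    rw [Real.sqrt_le_left (by positivity)]
    nlinarith [Real.pi_lt_d2, sq_pos_of_pos ht]
  have hpos : 0 < √(2 * Real.pi * t ^ 2) := Real.sqrt_pos.2 (by positivity)
  have hexp : (3 / 5 : ℝ) ≤ Real.exp (-(1 / 2)) := by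
    have h1 : Real.exp (1 / 2) ≤ 5 / 3 := by
      have h2 : Real.exp (1 / 2) ^ 2 = Real.exp 1 := by
        rw [← Real.exp_nat_mul]; norm_num
      have h3 := Real.exp_one_lt_d9
      have h4 := Real.exp_pos (1 / 2)
      nlinarith
    rw [Real.exp_neg, le_inv_comm₀ (by norm_num) (Real.exp_pos _)]
    linarith
  have hpdf : ∀ x ∈ Set.Icc u (u + t),
      ENNReal.ofReal (1 / (5 * t)) ≤ gaussianPDF m (Real.toNNReal t ^ 2) x := by
    intro x hx
    refine ENNReal.ofReal_le_ofReal ?_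
    rw [gaussianPDFReal, hv']
    have he : Real.exp (-(1 / 2)) ≤ Real.exp (-(x - m) ^ 2 / (2 * t ^ 2)) := by
      refine Real.exp_le_exp.2 ?_
      rw [neg_div, neg_le_neg_iff, div_le_iff₀ (by positivity)]
      have := sq_le_sq' (abs_le.1 (hum x hx)).1 (abs_le.1 (hum x hx)).2
      linarith
    calc 1 / (5 * t) = (3 * t)⁻¹ * (3 / 5) := by field_simp
      _ ≤ (√(2 * Real.pi * t ^ 2))⁻¹ * Real.exp (-(x - m) ^ 2 / (2 * t ^ 2)) :=
          mul_le_mul (inv_anti₀ hpos hpi) (hexp.trans he) (by norm_num) (by positivity)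
  calc ENNReal.ofReal (1 / 5) = ∫⁻ _ in Set.Icc u (u + t), ENNReal.ofReal (1 / (5 * t)) := by
        rw [lintegral_const, Measure.restrict_apply_univ, Real.volume_Icc,
          ← ENNReal.ofReal_mul (by positivity)]
        congr 1
        field_simp
        ring
    _ ≤ _ := setLIntegral_mono (measurable_gaussianPDF _ _) hpdf

/-- A narrow Gaussian has density at most `2 B / t` times that of the centred Gaussian with
standard deviation `B`, inside `[-B, B]`. -/
lemma gaussianReal_restrict_le {B m t : ℝ} (ht : 0 < t) (htB : t ≤ B) :
    (gaussianReal m (Real.toNNReal t ^ 2)).restrict (Set.Icc (-B) B) ≤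
      (Real.toNNReal (2 * (B / t))) •
        (gaussianReal 0 (Real.toNNReal B ^ 2)).restrict (Set.Icc (-B) B) := by
  have hB : 0 < B := ht.trans_le htB
  have hv : (Real.toNNReal t ^ 2 : ℝ≥0) ≠ 0 := by simpa using ht
  have hv' : ((Real.toNNReal t ^ 2 : ℝ≥0) : ℝ) = t ^ 2 := by
    simp [Real.coe_toNNReal _ ht.le]
  have hw : (Real.toNNReal B ^ 2 : ℝ≥0) ≠ 0 := by simpa using hB
  have hw' : ((Real.toNNReal B ^ 2 : ℝ≥0) : ℝ) = B ^ 2 := by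
    simp [Real.coe_toNNReal _ hB.le]
  refine Measure.le_iff.2 fun A hA => ?_
  rw [Measure.smul_apply, Measure.restrict_apply hA, Measure.restrict_apply hA,
    gaussianReal_apply _ hv, gaussianReal_apply _ hw, ENNReal.smul_def, smul_eq_mul,
    ← lintegral_const_mul _ (measurable_gaussianPDF _ _)]
  refine setLIntegral_mono ((measurable_gaussianPDF _ _).const_mul _) fun x hx => ?_
  have hxB : |x| ≤ B := abs_le.2 hx.2
  change ENNReal.ofReal _ ≤ ENNReal.ofReal _ * ENNReal.ofReal _
  rw [← ENNReal.ofReal_mul (by positivity)]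
  refine ENNReal.ofReal_le_ofReal ?_
  rw [gaussianPDFReal, gaussianPDFReal, hv', hw', Real.sqrt_mul' _ (sq_nonneg t),
    Real.sqrt_mul' _ (sq_nonneg B), Real.sqrt_sq ht.le, Real.sqrt_sq hB.le, sub_zero]
  have h1 : Real.exp (-(x - m) ^ 2 / (2 * t ^ 2)) ≤ 1 := by
    rw [Real.exp_le_one_iff]
    exact div_nonpos_of_nonpos_of_nonneg (by nlinarith [sq_nonneg (x - m)]) (by positivity)
  have h2 : (1 / 2 : ℝ) ≤ Real.exp (-x ^ 2 / (2 * B ^ 2)) := by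
    have h3 : -(1 / 2) ≤ -x ^ 2 / (2 * B ^ 2) := by
      rw [neg_div, neg_le_neg_iff, div_le_iff₀ (by positivity)]
      have := sq_le_sq' (abs_le.1 hxB).1 (abs_le.1 hxB).2
      linarith
    have := Real.add_one_le_exp (-x ^ 2 / (2 * B ^ 2))
    linarith
  have h5 : 0 < √(2 * Real.pi) := Real.sqrt_pos.2 (by positivity)
  calc (√(2 * Real.pi) * t)⁻¹ * Real.exp (-(x - m) ^ 2 / (2 * t ^ 2))
      ≤ (√(2 * Real.pi) * t)⁻¹ * 1 := by gcongr
    _ = 2 * (B / t) * ((√(2 * Real.pi) * B)⁻¹ * (1 / 2)) := by field_simp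
    _ ≤ _ := by gcongr

/-- The truncated Gaussian posterior with standard deviation `B / T` around `m` has, relative to the
truncated Gaussian prior with mean `0` and standard deviation `B`, a divergence of order
`log T` per weight. -/
lemma klDiv_weightLaw_le {ι : Type} [Fintype ι] {B : ℝ} (hB : 0 < B) {T : ℝ} (hT : 1 ≤ T)
    {m : ι → ℝ} (hm : m ∈ weightBox ι B) :
    InformationTheory.klDiv (weightLaw B (m, fun _ => Real.toNNReal (B / T) ^ 2))
      (weightLaw B ((fun _ => 0), fun _ => Real.toNNReal B ^ 2)) ≤
      ENNReal.ofReal (Fintype.card ι * Real.log (10 * T) + 1) := by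
  have hT0 : 0 < T := by linarith
  have ht : 0 < B / T := by positivity
  have htB : B / T ≤ B := div_le_self hB.le hT
  have h5 : (0 : ℝ≥0∞) < ENNReal.ofReal (1 / 5) := by simp
  have hmass := fun j => gaussianReal_Icc_ge ht htB (hm j)
  have hmass0 : ENNReal.ofReal (1 / 5) ≤ gaussianReal 0 (Real.toNNReal B ^ 2) (Set.Icc (-B) B) :=
    gaussianReal_Icc_ge hB le_rfl (by simpa using hB.le)
  have hne : ∀ j, gaussianReal (m j) (Real.toNNReal (B / T) ^ 2) (Set.Icc (-B) B) ≠ 0 :=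
    fun j => (h5.trans_le (hmass j)).ne'
  have hne0 : gaussianReal 0 (Real.toNNReal B ^ 2) (Set.Icc (-B) B) ≠ 0 :=
    (h5.trans_le hmass0).ne'
  rw [weightLaw_eq_pi B (m, fun _ => Real.toNNReal (B / T) ^ 2) hne,
    weightLaw_eq_pi B ((fun _ => 0), fun _ => Real.toNNReal B ^ 2) fun _ => hne0]
  have := fun j => cond_isProbabilityMeasure (hne j)
  have := cond_isProbabilityMeasure hne0
  have hc0 : (0 : ℝ) < 10 * T := by positivity
  have hle : ∀ j, ProbabilityTheory.cond (gaussianReal (m j) (Real.toNNReal (B / T) ^ 2))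
      (Set.Icc (-B) B) ≤ Real.toNNReal (10 * T) •
        ProbabilityTheory.cond (gaussianReal 0 (Real.toNNReal B ^ 2)) (Set.Icc (-B) B) := by
    intro j
    refine Measure.le_iff.2 fun A hA => ?_
    have h1 := gaussianReal_restrict_le (m := m j) ht htB A
    rw [show 2 * (B / (B / T)) = 2 * T by field_simp] at h1
    rw [Measure.smul_apply, ENNReal.smul_def, smul_eq_mul] at h1 ⊢
    rw [ProbabilityTheory.cond, ProbabilityTheory.cond, Measure.smul_apply, Measure.smul_apply,
      smul_eq_mul, smul_eq_mul]
    have h2 : (gaussianReal (m j) (Real.toNNReal (B / T) ^ 2) (Set.Icc (-B) B))⁻¹ ≤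
        ENNReal.ofReal 5 := by
      rw [ENNReal.inv_le_iff_inv_le, ← ENNReal.ofReal_inv_of_pos (by norm_num)]
      exact le_trans (by norm_num) (hmass j)
    have h3 : (1 : ℝ≥0∞) ≤ (gaussianReal 0 (Real.toNNReal B ^ 2) (Set.Icc (-B) B))⁻¹ :=
      ENNReal.one_le_inv.2 prob_le_one
    have h4 : ((Real.toNNReal (10 * T) : ℝ≥0) : ℝ≥0∞) =
        ENNReal.ofReal 5 * (Real.toNNReal (2 * T) : ℝ≥0) := by
      change ENNReal.ofReal (10 * T) = ENNReal.ofReal 5 * ENNReal.ofReal (2 * T)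
      rw [← ENNReal.ofReal_mul (by norm_num)]
      congr 1
      ring
    calc _ ≤ ENNReal.ofReal 5 * ((Real.toNNReal (2 * T) : ℝ≥0) *
          (gaussianReal 0 (Real.toNNReal B ^ 2)).restrict (Set.Icc (-B) B) A) := by gcongr
      _ = (Real.toNNReal (10 * T) : ℝ≥0) * (1 *
          (gaussianReal 0 (Real.toNNReal B ^ 2)).restrict (Set.Icc (-B) B) A) := by
            rw [h4]; ring
      _ ≤ _ := by gcongr
  have h10 : 1 ≤ Real.toNNReal (10 * T) := by
    rw [Real.one_le_toNNReal]; linarith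
  refine (klDiv_le_of_le_smul (one_le_pow₀ h10)
    (pi_le_smul_pi (by positivity) hle)).trans (le_of_eq ?_)
  rw [NNReal.coe_pow, Real.log_pow, Real.coe_toNNReal _ hc0.le]

lemma lintegral_sq_sub_weightLaw_le {ι : Type} [Fintype ι] {B t : ℝ} (ht : 0 < t) (htB : t ≤ B)
    {m : ι → ℝ} (hm : m ∈ weightBox ι B) (j : ι) :
    ∫⁻ w, ENNReal.ofReal ((w j - m j) ^ 2) ∂weightLaw B (m, fun _ => Real.toNNReal t ^ 2) ≤
      ENNReal.ofReal (5 * t ^ 2) := by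
  have h5 : (0 : ℝ≥0∞) < ENNReal.ofReal (1 / 5) := by simp
  have hmass := fun j => gaussianReal_Icc_ge ht htB (hm j)
  have hne : ∀ j, gaussianReal (m j) (Real.toNNReal t ^ 2) (Set.Icc (-B) B) ≠ 0 :=
    fun j => (h5.trans_le (hmass j)).ne'
  have := fun j => cond_isProbabilityMeasure (hne j)
  rw [weightLaw_eq_pi B (m, fun _ => Real.toNNReal t ^ 2) hne]
  have hmp := measurePreserving_eval (fun j => ProbabilityTheory.cond
    (gaussianReal (m j) (Real.toNNReal t ^ 2)) (Set.Icc (-B) B)) j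
  have hmeas : Measurable fun u : ℝ => ENNReal.ofReal ((u - m j) ^ 2) := by fun_prop
  have e1 := hmp.lintegral_comp hmeas
  simp only [Function.eval] at e1
  rw [e1, ProbabilityTheory.cond, lintegral_smul_measure]
  have hvar : ∫⁻ u, ENNReal.ofReal ((u - m j) ^ 2) ∂gaussianReal (m j) (Real.toNNReal t ^ 2) =
      ENNReal.ofReal (t ^ 2) := by
    have h1 := ofReal_variance (X := id) (memLp_id_gaussianReal' (μ := m j)
      (v := Real.toNNReal t ^ 2) 2 (by simp))
    rw [variance_id_gaussianReal] at h1
    rw [evariance_eq_lintegral_ofReal] at h1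
    simp only [id, integral_id_gaussianReal] at h1
    rw [← h1]
    simp [Real.coe_toNNReal _ ht.le]
  have h2 : (gaussianReal (m j) (Real.toNNReal t ^ 2) (Set.Icc (-B) B))⁻¹ ≤
      ENNReal.ofReal 5 := by
    rw [ENNReal.inv_le_iff_inv_le, ← ENNReal.ofReal_inv_of_pos (by norm_num)]
    exact le_trans (by norm_num) (hmass j)
  rw [smul_eq_mul]
  calc _ ≤ ENNReal.ofReal 5 * ∫⁻ u, ENNReal.ofReal ((u - m j) ^ 2)
        ∂gaussianReal (m j) (Real.toNNReal t ^ 2) := by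
        gcongr; exact Measure.restrict_le_self
    _ = _ := by rw [hvar, ← ENNReal.ofReal_mul (by norm_num)]

/-! ### Exponential moments of the excess loss -/

lemma lintegral_pi_prod {ι α : Type*} [Fintype ι] [MeasurableSpace α] (ν : ι → Measure α)
    [∀ i, IsProbabilityMeasure (ν i)] {F : ι → α → ℝ≥0∞} (hF : ∀ i, Measurable (F i)) :
    ∫⁻ x, ∏ i, F i (x i) ∂Measure.pi ν = ∏ i, ∫⁻ u, F i u ∂ν i := by
  rw [lintegral_prod_eq_prod_lintegral_of_indepFun Finset.univ (fun i (x : ι → α) => F i (x i))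
    (iIndepFun_pi fun i => (hF i).aemeasurable) fun i => (hF i).comp (measurable_pi_apply i)]
  exact Finset.prod_congr rfl fun i _ =>
    (measurePreserving_eval ν i).lintegral_comp (hF i)

lemma lintegral_exp_mul_gaussianReal (v : ℝ≥0) (t : ℝ) :
    ∫⁻ u, ENNReal.ofReal (Real.exp (t * u)) ∂gaussianReal 0 v =
      ENNReal.ofReal (Real.exp (v * t ^ 2 / 2)) := by
  rw [← ofReal_integral_eq_lintegral_ofReal (ProbabilityTheory.integrable_exp_mul_gaussianReal t)
    (Filter.Eventually.of_forall fun _ => (Real.exp_pos _).le)]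
  have := congrFun (mgf_id_gaussianReal (μ := 0) (v := v)) t
  simp only [mgf, id, zero_mul, zero_add] at this
  rw [this]

section
variable {s₀ K n : ℕ} {μ : Measure (Fin s₀ → ℝ)}
  {f : (Fin s₀ → ℝ) → Fin K → ℝ} {s : ℝ≥0}

@[fun_prop]
lemma measurable_sqDist {α : Type*} [MeasurableSpace α] {g h : α → Fin K → ℝ} (hg : Measurable g)
    (hh : Measurable h) : Measurable fun x => sqDist (g x) (h x) := by
  unfold sqDist
  fun_prop

lemma measurable_regressionMap (hf : Measurable f) :
    Measurable fun z : (Fin s₀ → ℝ) × (Fin K → ℝ) => (z.1, f z.1 + z.2) := by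
  fun_prop

lemma ae_regressionLaw_mem (hf : Measurable f) {S : Set (Fin s₀ → ℝ)} (hS : ∀ᵐ x ∂μ, x ∈ S) :
    ∀ᵐ z ∂regressionLaw μ f s, z.1 ∈ S := by
  have h1 : (regressionLaw μ f s).map Prod.fst = μ := by
    rw [regressionLaw, Measure.map_map measurable_fst (measurable_regressionMap hf)]
    exact Measure.map_fst_prod.trans (by simp)
  rw [← h1] at hS
  exact ae_of_ae_map measurable_fst.aemeasurable hS

lemma lintegral_regressionLaw (hf : Measurable f)
    {F : (Fin s₀ → ℝ) × (Fin K → ℝ) → ℝ≥0∞} (hF : Measurable F) :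
    ∫⁻ z, F z ∂regressionLaw μ f s = ∫⁻ x, ∫⁻ e, F (x, f x + e)
      ∂(Measure.pi fun _ : Fin K => gaussianReal 0 (s ^ 2)) ∂μ := by
  rw [regressionLaw, lintegral_map hF (measurable_regressionMap hf),
    lintegral_prod (fun z : (Fin s₀ → ℝ) × (Fin K → ℝ) => F (z.1, f z.1 + z.2))
      (hF.comp (measurable_regressionMap hf)).aemeasurable]

lemma lintegral_exp_regressionLaw (hf : Measurable f) {g : (Fin s₀ → ℝ) → Fin K → ℝ}
    (hg : Measurable g) {b : (Fin s₀ → ℝ) → ℝ} (hb : Measurable b) (a : ℝ) :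
    ∫⁻ z, ENNReal.ofReal (Real.exp (a * ∑ k, (z.2 k - f z.1 k) * g z.1 k + b z.1))
        ∂regressionLaw μ f s =
      ∫⁻ x, ENNReal.ofReal (Real.exp (a ^ 2 * s ^ 2 / 2 * ∑ k, g x k ^ 2 + b x)) ∂μ := by
  rw [lintegral_regressionLaw hf (by fun_prop)]
  refine lintegral_congr fun x => ?_
  have e : ∀ e : Fin K → ℝ, ENNReal.ofReal (Real.exp
      (a * ∑ k, ((f x + e) k - f x k) * g x k + b x)) =
      ENNReal.ofReal (Real.exp (b x)) *
        ∏ k, ENNReal.ofReal (Real.exp ((a * g x k) * e k)) := by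
    intro e
    rw [← ENNReal.ofReal_prod_of_nonneg fun _ _ => (Real.exp_pos _).le, ← Real.exp_sum,
      ← ENNReal.ofReal_mul (Real.exp_pos _).le, ← Real.exp_add, Finset.mul_sum, add_comm]
    congr 3
    refine Finset.sum_congr rfl fun k _ => ?_
    simp only [Pi.add_apply]
    ring
  simp only [e]
  rw [lintegral_const_mul _ (by fun_prop), lintegral_pi_prod
    (fun _ : Fin K => gaussianReal 0 (s ^ 2))
    (F := fun k u => ENNReal.ofReal (Real.exp ((a * g x k) * u))) (by fun_prop)]
  simp only [lintegral_exp_mul_gaussianReal]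
  rw [← ENNReal.ofReal_prod_of_nonneg fun _ _ => (Real.exp_pos _).le, ← Real.exp_sum,
    ← ENNReal.ofReal_mul (Real.exp_pos _).le, ← Real.exp_add, Finset.mul_sum, add_comm]
  congr 3
  refine Finset.sum_congr rfl fun k _ => ?_
  push_cast
  ring

variable [IsProbabilityMeasure μ]

lemma isProbabilityMeasure_regressionLaw (hf : Measurable f) :
    IsProbabilityMeasure (regressionLaw μ f s) := by
  unfold regressionLaw
  exact Measure.isProbabilityMeasure_map (measurable_regressionMap hf).aemeasurable

lemma lintegral_sqDist_regressionLaw (hf : Measurable f) :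
    ∫⁻ z, ENNReal.ofReal (sqDist z.2 (f z.1)) ∂regressionLaw μ f s =
      ENNReal.ofReal (K * (s : ℝ) ^ 2) := by
  rw [lintegral_regressionLaw hf (by fun_prop)]
  have hvar : ∫⁻ u, ENNReal.ofReal (u ^ 2) ∂gaussianReal 0 (s ^ 2) =
      ENNReal.ofReal ((s : ℝ) ^ 2) := by
    have h1 := ofReal_variance (X := id) (memLp_id_gaussianReal' (μ := 0)
      (v := s ^ 2) 2 (by simp))
    rw [variance_id_gaussianReal, evariance_eq_lintegral_ofReal] at h1
    simp only [id, integral_id_gaussianReal, sub_zero] at h1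
    rw [← h1]
    simp
  have e : ∀ (x : Fin s₀ → ℝ) (e : Fin K → ℝ), ENNReal.ofReal (sqDist (f x + e) (f x)) =
      ∑ k, ENNReal.ofReal (e k ^ 2) := by
    intro x e
    rw [← ENNReal.ofReal_sum_of_nonneg fun _ _ => sq_nonneg _]
    simp [sqDist]
  simp only [e]
  have h2 : ∀ k : Fin K, ∫⁻ e : Fin K → ℝ, ENNReal.ofReal (e k ^ 2)
      ∂(Measure.pi fun _ : Fin K => gaussianReal 0 (s ^ 2)) = ENNReal.ofReal ((s : ℝ) ^ 2) := by
    intro k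
    rw [← hvar]
    exact (measurePreserving_eval (fun _ : Fin K => gaussianReal 0 (s ^ 2)) k).lintegral_comp
      (f := fun u : ℝ => ENNReal.ofReal (u ^ 2)) (by fun_prop)
  rw [lintegral_const, measure_univ, mul_one, lintegral_finsetSum _ (by fun_prop)]
  simp only [h2, Finset.sum_const, Finset.card_univ, Fintype.card_fin, nsmul_eq_mul]
  rw [ENNReal.ofReal_mul (by positivity), ENNReal.ofReal_natCast]

lemma ae_dataLaw_mem (hf : Measurable f) {S : Set (Fin s₀ → ℝ)} (hS : ∀ᵐ x ∂μ, x ∈ S) :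
    ∀ᵐ D ∂dataLaw n μ f s, ∀ m, (D m).1 ∈ S := by
  have := isProbabilityMeasure_regressionLaw (μ := μ) (s := s) hf
  rw [ae_all_iff]
  intro m
  exact (measurePreserving_eval (fun _ : Fin n => regressionLaw μ f s)
    m).quasiMeasurePreserving.ae (ae_regressionLaw_mem hf hS)

lemma lintegral_exp_sum_dataLaw (hf : Measurable f)
    {F : (Fin s₀ → ℝ) × (Fin K → ℝ) → ℝ} (hF : Measurable F) :
    ∫⁻ D, ENNReal.ofReal (Real.exp (∑ m, F (D m))) ∂dataLaw n μ f s =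
      (∫⁻ z, ENNReal.ofReal (Real.exp (F z)) ∂regressionLaw μ f s) ^ n := by
  have := isProbabilityMeasure_regressionLaw (μ := μ) (s := s) hf
  have e : ∀ D : Dataset s₀ K n, ENNReal.ofReal (Real.exp (∑ m, F (D m))) =
      ∏ m, ENNReal.ofReal (Real.exp (F (D m))) := fun D => by
    rw [← ENNReal.ofReal_prod_of_nonneg fun _ _ => (Real.exp_pos _).le, Real.exp_sum]
  simp only [e]
  rw [dataLaw, lintegral_pi_prod (fun _ : Fin n => regressionLaw μ f s)
    (F := fun _ z => ENNReal.ofReal (Real.exp (F z))) (by fun_prop)]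
  simp

lemma lintegral_sum_sqDist_dataLaw (hf : Measurable f) :
    ∫⁻ D, ENNReal.ofReal (∑ m, sqDist (D m).2 (f (D m).1)) ∂dataLaw n μ f s =
      ENNReal.ofReal (n * (K * (s : ℝ) ^ 2)) := by
  have := isProbabilityMeasure_regressionLaw (μ := μ) (s := s) hf
  have hF : Measurable fun z : (Fin s₀ → ℝ) × (Fin K → ℝ) =>
      ENNReal.ofReal (sqDist z.2 (f z.1)) := by
    fun_prop
  have e : ∀ D : Dataset s₀ K n, ENNReal.ofReal (∑ m, sqDist (D m).2 (f (D m).1)) =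
      ∑ m, ENNReal.ofReal (sqDist (D m).2 (f (D m).1)) := fun D =>
    ENNReal.ofReal_sum_of_nonneg fun _ _ => Finset.sum_nonneg fun _ _ => sq_nonneg _
  simp only [e]
  have h2 : ∀ m : Fin n, ∫⁻ D, ENNReal.ofReal (sqDist (D m).2 (f (D m).1)) ∂dataLaw n μ f s =
      ENNReal.ofReal (K * (s : ℝ) ^ 2) := fun m =>
    ((measurePreserving_eval (fun _ : Fin n => regressionLaw μ f s) m).lintegral_comp hF).trans
      (lintegral_sqDist_regressionLaw hf)
  rw [lintegral_finsetSum _ fun m _ => by fun_prop]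
  simp only [h2, Finset.sum_const, Finset.card_univ, Fintype.card_fin, nsmul_eq_mul]
  rw [ENNReal.ofReal_mul (p := (n : ℝ)) (by positivity), ENNReal.ofReal_natCast]

/-- The log-likelihood ratio of the data between the regression functions `f` and `g`: the excess
loss of `g` over `f`. -/
noncomputable def excessLoss (s : ℝ≥0) (g f : (Fin s₀ → ℝ) → Fin K → ℝ) (D : Dataset s₀ K n) : ℝ :=
  (∑ m, (sqDist (D m).2 (g (D m).1) - sqDist (D m).2 (f (D m).1))) / (2 * (s : ℝ) ^ 2)

lemma negLogLik_sub (hs : 0 < s) (g f : (Fin s₀ → ℝ) → Fin K → ℝ) (D : Dataset s₀ K n) :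
    negLogLik s g D = negLogLik s f D + excessLoss s g f D := by
  have hs2 : s ^ 2 ≠ 0 := by positivity
  have key : ∀ h : (Fin s₀ → ℝ) → Fin K → ℝ, negLogLik s h D =
      (n : ℝ) * (K * Real.log √(2 * Real.pi * s ^ 2)) +
        (∑ m, sqDist (D m).2 (h (D m).1)) / (2 * (s : ℝ) ^ 2) := by
    intro h
    have hk : ∀ m k, Real.log (gaussianPDFReal (h (D m).1 k) (s ^ 2) ((D m).2 k)) =
        -Real.log √(2 * Real.pi * s ^ 2) -
          ((D m).2 k - h (D m).1 k) ^ 2 / (2 * (s : ℝ) ^ 2) := by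
      intro m k
      have hpos : 0 < √(2 * Real.pi * (s : ℝ) ^ 2) := Real.sqrt_pos.2 (by positivity)
      rw [gaussianPDFReal, NNReal.coe_pow, Real.log_mul (inv_pos.2 hpos).ne' (Real.exp_pos _).ne',
        Real.log_exp, Real.log_inv]
      ring
    have hne : ∀ m k, gaussianPDFReal (h (D m).1 k) (s ^ 2) ((D m).2 k) ≠ 0 := fun m k =>
      (gaussianPDFReal_pos _ _ _ hs2).ne'
    rw [negLogLik, Real.log_prod fun m _ => Finset.prod_ne_zero_iff.2 fun k _ => hne m k]
    simp only [Real.log_prod fun k _ => hne _ k, hk, Finset.sum_sub_distrib, Finset.sum_const,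
      Finset.card_univ, Fintype.card_fin, nsmul_eq_mul, ← Finset.sum_div, sqDist]
    ring
  rw [key, key, excessLoss, Finset.sum_sub_distrib]
  ring

lemma measurable_excessLoss {g : (Fin s₀ → ℝ) → Fin K → ℝ} (hg : Measurable g)
    (hf : Measurable f) : Measurable fun D : Dataset s₀ K n => excessLoss s g f D := by
  unfold excessLoss
  fun_prop

lemma sqDist_sub_sqDist (y u v : Fin K → ℝ) :
    sqDist y u - sqDist y v = -2 * ∑ k, (y k - v k) * (u k - v k) + sqDist u v := by
  simp only [sqDist, Finset.mul_sum, ← Finset.sum_sub_distrib, ← Finset.sum_add_distrib]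
  exact Finset.sum_congr rfl fun k _ => by ring

lemma sqDist_nonneg (u v : Fin K → ℝ) : 0 ≤ sqDist u v := Finset.sum_nonneg fun _ _ => sq_nonneg _

lemma integrable_hellinger_integrand {g : (Fin s₀ → ℝ) → Fin K → ℝ} (hg : Measurable g)
    (hf : Measurable f) :
    Integrable (fun x => 1 - Real.exp (-sqDist (g x) (f x) / (8 * (s : ℝ) ^ 2))) μ := by
  have hm : Measurable fun x => 1 - Real.exp (-sqDist (g x) (f x) / (8 * (s : ℝ) ^ 2)) := by
    fun_prop
  refine Integrable.of_bound hm.aestronglyMeasurable 1 (Filter.Eventually.of_forall fun x => ?_)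
  have h1 : Real.exp (-sqDist (g x) (f x) / (8 * (s : ℝ) ^ 2)) ≤ 1 := by
    rw [Real.exp_le_one_iff, neg_div, neg_nonpos]
    have := sqDist_nonneg (g x) (f x)
    positivity
  rw [Real.norm_of_nonneg (by linarith)]
  linarith [Real.exp_pos (-sqDist (g x) (f x) / (8 * (s : ℝ) ^ 2))]

/-- The moment of order `1/2` of the likelihood ratio is the `n`-th power of the Hellinger
affinity. -/
lemma lintegral_exp_neg_half_excessLoss_le (hs : 0 < s) {g : (Fin s₀ → ℝ) → Fin K → ℝ}
    (hg : Measurable g) (hf : Measurable f) :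
    ∫⁻ D, ENNReal.ofReal (Real.exp (n * hellingerSq s μ g f - excessLoss s g f D / 2))
      ∂dataLaw n μ f s ≤ 1 := by
  have hs0 : (s : ℝ) ≠ 0 := by exact_mod_cast hs.ne'
  have e : ∀ D : Dataset s₀ K n, n * hellingerSq s μ g f - excessLoss s g f D / 2 =
      ∑ m, (1 / (2 * (s : ℝ) ^ 2) * ∑ k, ((D m).2 k - f (D m).1 k) *
        (g (D m).1 k - f (D m).1 k) +
        (hellingerSq s μ g f - sqDist (g (D m).1) (f (D m).1) / (4 * (s : ℝ) ^ 2))) := by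
    intro D
    simp only [excessLoss, sqDist_sub_sqDist, Finset.sum_add_distrib, Finset.sum_sub_distrib,
      Finset.sum_const, Finset.card_univ, Fintype.card_fin, nsmul_eq_mul, ← Finset.mul_sum,
      ← Finset.sum_div]
    field_simp
    ring
  simp only [e]
  rw [lintegral_exp_sum_dataLaw hf (F := fun z => 1 / (2 * (s : ℝ) ^ 2) *
    ∑ k, (z.2 k - f z.1 k) * (g z.1 k - f z.1 k) +
        (hellingerSq s μ g f - sqDist (g z.1) (f z.1) / (4 * (s : ℝ) ^ 2))) (by fun_prop),
    lintegral_exp_regressionLaw (g := fun x k => g x k - f x k)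
    (b := fun x => hellingerSq s μ g f - sqDist (g x) (f x) / (4 * (s : ℝ) ^ 2)) hf (by fun_prop)
    (by fun_prop)]
  refine pow_le_one₀ zero_le ?_
  have e2 : ∀ x, Real.exp ((1 / (2 * (s : ℝ) ^ 2)) ^ 2 * s ^ 2 / 2 * ∑ k, (g x k - f x k) ^ 2 +
      (hellingerSq s μ g f - sqDist (g x) (f x) / (4 * (s : ℝ) ^ 2))) =
      Real.exp (hellingerSq s μ g f) * (1 -
        (1 - Real.exp (-sqDist (g x) (f x) / (8 * (s : ℝ) ^ 2)))) := by
    intro x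
    rw [sub_sub_cancel, ← Real.exp_add, ← sqDist]
    congr 1
    field_simp
    ring
  simp only [e2]
  have hint := integrable_hellinger_integrand (μ := μ) (s := s) hg hf
  rw [← ofReal_integral_eq_lintegral_ofReal (f := fun x => Real.exp (hellingerSq s μ g f) * (1 -
      (1 - Real.exp (-sqDist (g x) (f x) / (8 * (s : ℝ) ^ 2)))))
    (((integrable_const 1).sub hint).const_mul _) (Filter.Eventually.of_forall fun x => by
      simp only [sub_sub_cancel, Pi.zero_apply]; positivity), integral_const_mul,
    integral_sub (integrable_const 1) hint, ← ENNReal.ofReal_one]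
  refine ENNReal.ofReal_le_ofReal ?_
  rw [← hellingerSq]
  simp only [integral_const, probReal_univ, smul_eq_mul, mul_one]
  calc Real.exp (hellingerSq s μ g f) * (1 - hellingerSq s μ g f)
      ≤ Real.exp (hellingerSq s μ g f) * Real.exp (-hellingerSq s μ g f) := by
        gcongr
        exact Real.one_sub_le_exp_neg _
    _ = 1 := by rw [← Real.exp_add, add_neg_cancel, Real.exp_zero]

/-- Given the covariates, the excess loss is Gaussian with variance twice its mean, so that
subtracting twice the mean makes its exponential have expectation one. -/
lemma lintegral_exp_excessLoss (hs : 0 < s) {g : (Fin s₀ → ℝ) → Fin K → ℝ}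
    (hg : Measurable g) (hf : Measurable f) :
    ∫⁻ D, ENNReal.ofReal (Real.exp (excessLoss s g f D -
      (∑ m, sqDist (g (D m).1) (f (D m).1)) / (s : ℝ) ^ 2)) ∂dataLaw n μ f s = 1 := by
  have hs0 : (s : ℝ) ≠ 0 := by exact_mod_cast hs.ne'
  have e : ∀ D : Dataset s₀ K n, excessLoss s g f D -
      (∑ m, sqDist (g (D m).1) (f (D m).1)) / (s : ℝ) ^ 2 =
      ∑ m, (-1 / ((s : ℝ) ^ 2) * ∑ k, ((D m).2 k - f (D m).1 k) *
        (g (D m).1 k - f (D m).1 k) +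
        -(sqDist (g (D m).1) (f (D m).1) / (2 * (s : ℝ) ^ 2))) := by
    intro D
    simp only [excessLoss, sqDist_sub_sqDist, Finset.sum_add_distrib, Finset.sum_neg_distrib,
      ← Finset.mul_sum, ← Finset.sum_div]
    field_simp
    ring
  simp only [e]
  rw [lintegral_exp_sum_dataLaw hf (F := fun z => -1 / ((s : ℝ) ^ 2) *
    ∑ k, (z.2 k - f z.1 k) * (g z.1 k - f z.1 k) +
        -(sqDist (g z.1) (f z.1) / (2 * (s : ℝ) ^ 2))) (by fun_prop),
    lintegral_exp_regressionLaw (g := fun x k => g x k - f x k)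
    (b := fun x => -(sqDist (g x) (f x) / (2 * (s : ℝ) ^ 2))) hf (by fun_prop)
    (by fun_prop)]
  have e2 : ∀ x, Real.exp ((-1 / ((s : ℝ) ^ 2)) ^ 2 * s ^ 2 / 2 * ∑ k, (g x k - f x k) ^ 2 +
      -(sqDist (g x) (f x) / (2 * (s : ℝ) ^ 2))) = 1 := by
    intro x
    rw [Real.exp_eq_one_iff, ← sqDist]
    field_simp
    ring
  simp only [e2]
  simp

end

/-! ### Uniform deviations over the weight box -/

section
variable {K : ℕ}

lemma sqDist_triangle (u v t : Fin K → ℝ) : sqDist u t ≤ 2 * sqDist u v + 2 * sqDist v t := by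
  simp only [sqDist, Finset.mul_sum, ← Finset.sum_add_distrib]
  exact Finset.sum_le_sum fun k _ => by nlinarith [sq_nonneg (u k - v k - (v k - t k))]

lemma two_mul_le_div_add {a b c : ℝ} (ha : 0 < a) : 2 * b * c ≤ b ^ 2 / a + a * c ^ 2 := by
  rw [← sub_nonneg, show b ^ 2 / a + a * c ^ 2 - 2 * b * c = (b - a * c) ^ 2 / a by
    field_simp; ring]
  positivity

/-- Changing a prediction `u` to `v` when the response is `y` and its mean is `f`. Young's inequality
with the weights `n` and `a` splits off the noise `y - f` and the error `v - f`. -/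
lemma sqDist_sub_sqDist_le (y f u v : Fin K → ℝ) {n a : ℝ} (hn : 0 < n) (ha : 0 < a) :
    sqDist y v - sqDist y u ≤
      sqDist y f / n + (n + a) * sqDist u v + sqDist v f / a := by
  simp only [sqDist, Finset.mul_sum, Finset.sum_div, ← Finset.sum_add_distrib,
    ← Finset.sum_sub_distrib]
  refine Finset.sum_le_sum fun k _ => ?_
  have h1 := two_mul_le_div_add (b := y k - f k) (c := u k - v k) hn
  have h2 := two_mul_le_div_add (b := v k - f k) (c := -(u k - v k)) ha
  nlinarith [sq_nonneg (u k - v k)]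

lemma sqDist_sub_sqDist_le_one (y f u v : Fin K → ℝ) {n : ℝ} (hn : 0 < n) :
    sqDist y u - sqDist y v ≤ sqDist y f / n + (n + 2) * sqDist u v + sqDist v f := by
  simp only [sqDist, Finset.mul_sum, Finset.sum_div, ← Finset.sum_add_distrib,
    ← Finset.sum_sub_distrib]
  refine Finset.sum_le_sum fun k _ => ?_
  have h1 := two_mul_le_div_add (b := y k - f k) (c := -(u k - v k)) hn
  nlinarith [sq_nonneg (v k - f k - (u k - v k))]

lemma sqDist_sub_sqDist_le' (f u v : Fin K → ℝ) {a : ℝ} (ha : 0 < a) :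
    sqDist u f - sqDist v f ≤ (a + 1) * sqDist u v + sqDist v f / a := by
  simp only [sqDist, Finset.mul_sum, Finset.sum_div, ← Finset.sum_add_distrib,
    ← Finset.sum_sub_distrib]
  refine Finset.sum_le_sum fun k _ => ?_
  have h2 := two_mul_le_div_add (b := v k - f k) (c := u k - v k) ha
  nlinarith

end

lemma exp_neg_sub_exp_neg_le {a b c : ℝ} (ha : 0 ≤ a) (hc : 0 ≤ c) (h : b - a ≤ c) :
    Real.exp (-a) - Real.exp (-b) ≤ c := by
  have h1 : Real.exp (-a) ≤ 1 := Real.exp_le_one_iff.2 (by linarith)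
  have h2 : Real.exp (-b) = Real.exp (-a) * Real.exp (-(b - a)) := by
    rw [← Real.exp_add]; congr 1; ring
  have h3 := Real.one_sub_le_exp_neg (b - a)
  have h4 := Real.exp_pos (-a)
  rw [h2]
  calc Real.exp (-a) - Real.exp (-a) * Real.exp (-(b - a))
      = Real.exp (-a) * (1 - Real.exp (-(b - a))) := by ring
    _ ≤ Real.exp (-a) * c := by gcongr; linarith
    _ ≤ 1 * c := by gcongr
    _ = c := one_mul c

/-- The centre of a cell of the box, when each edge is cut into `T` intervals of length
`2 B / T`. -/
noncomputable def gridPoint {ι : Type} (B : ℝ) (T : ℕ) (k : ι → Fin T) : ι → ℝ :=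
  fun j => -B + (2 * (k j : ℝ) + 1) * (B / T)

lemma gridPoint_mem {ι : Type} {B : ℝ} (hB : 0 < B) {T : ℕ} (hT : 1 ≤ T) (k : ι → Fin T) :
    gridPoint B T k ∈ weightBox ι B := by
  intro j
  have hT0 : (0 : ℝ) < T := by exact_mod_cast hT
  have hk : (k j : ℝ) + 1 ≤ T := by exact_mod_cast (k j).2
  have hr : 0 < B / T := by positivity
  have hTr : (T : ℝ) * (B / T) = B := by field_simp
  have hk0 : (0 : ℝ) ≤ (k j : ℝ) := Nat.cast_nonneg _
  rw [abs_le, gridPoint]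
  constructor <;> nlinarith

lemma exists_gridPoint_near {ι : Type} {B : ℝ} (hB : 0 < B) {T : ℕ} (hT : 1 ≤ T) {w : ι → ℝ}
    (hw : w ∈ weightBox ι B) : ∃ k : ι → Fin T, ∀ j, |w j - gridPoint B T k j| ≤ B / T := by
  have hT0 : (0 : ℝ) < T := by exact_mod_cast hT
  have hr : 0 < B / T := by positivity
  have hTr : (T : ℝ) * (B / T) = B := by field_simp
  have h1 : ∀ t : ℝ, |t| ≤ B → ∃ k : Fin T, |t - (-B + (2 * (k : ℝ) + 1) * (B / T))| ≤ B / T := by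
    intro t ht
    rw [abs_le] at ht
    set r := B / T with hrdef
    set u := (t + B) / (2 * r) with hu
    have hu0 : 0 ≤ u := div_nonneg (by linarith) (by linarith)
    have hut : t + B = 2 * r * u := by rw [hu]; field_simp
    have huT : u ≤ T := by
      rw [hu, div_le_iff₀ (by linarith)]; nlinarith
    rcases huT.lt_or_eq with h | h
    · refine ⟨⟨⌊u⌋₊, (Nat.floor_lt hu0).2 h⟩, ?_⟩
      have f1 := Nat.floor_le hu0
      have f2 := Nat.lt_floor_add_one u
      rw [abs_le]
      simp only
      constructor <;> nlinarith
    · refine ⟨⟨T - 1, by omega⟩, ?_⟩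
      simp only [Nat.cast_sub hT, Nat.cast_one]
      rw [abs_le]
      constructor <;> nlinarith
  choose k hk using fun j => h1 (w j) (hw j)
  exact ⟨k, hk⟩

lemma integrable_weightLaw {ι : Type} [Fintype ι] {B : ℝ} {a : GaussParam ι}
    [IsFiniteMeasure (weightLaw B a)] {g : (ι → ℝ) → ℝ} (hg : Continuous g) :
    Integrable g (weightLaw B a) := by
  have hc : IsCompact (weightBox ι B) := by
    rw [weightBox_eq_pi]
    exact isCompact_univ_pi fun _ => isCompact_Icc
  obtain ⟨C, hC⟩ := hc.exists_bound_of_continuousOn hg.continuousOn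
  exact Integrable.of_bound hg.aestronglyMeasurable C
    ((ae_weightLaw_mem B a).mono hC)

section
variable {ι : Type} [Fintype ι] {s₀ K n : ℕ} {μ : Measure (Fin s₀ → ℝ)}
  {f : (Fin s₀ → ℝ) → Fin K → ℝ} {s : ℝ≥0} {F : (ι → ℝ) → (Fin s₀ → ℝ) → Fin K → ℝ}
  {S : Set (Fin s₀ → ℝ)} {B Λ ξ : ℝ} {w₀ : ι → ℝ} {T : ℕ} [DecidableEq ι]

/-- The average over the grid of the exponentials of `n` times the squared Hellinger distance minus
half the excess loss. Each of them has expectation at most one. -/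
noncomputable def gridMoment (μ : Measure (Fin s₀ → ℝ)) (f : (Fin s₀ → ℝ) → Fin K → ℝ) (s : ℝ≥0)
    (F : (ι → ℝ) → (Fin s₀ → ℝ) → Fin K → ℝ) (B : ℝ) (T : ℕ) (D : Dataset s₀ K n) : ℝ :=
  ((T : ℝ) ^ Fintype.card ι)⁻¹ * ∑ k : ι → Fin T,
    Real.exp (n * hellingerSq s μ (F (gridPoint B T k)) f -
      excessLoss s (F (gridPoint B T k)) f D / 2)

/-- The mean over the sample of the squared noise. -/
noncomputable def noiseEnergy (f : (Fin s₀ → ℝ) → Fin K → ℝ) (D : Dataset s₀ K n) : ℝ :=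
  (∑ m, sqDist (D m).2 (f (D m).1)) / n

lemma noiseEnergy_nonneg (D : Dataset s₀ K n) : 0 ≤ noiseEnergy f D :=
  div_nonneg (Finset.sum_nonneg fun _ _ => sqDist_nonneg _ _) (Nat.cast_nonneg _)

/-- A union bound over the grid in the form of an inequality between functions of the data: a
summand is at most the sum, and `x ≤ exp x`. -/
lemma gridPoint_bound (D : Dataset s₀ K n) (hT : 1 ≤ T) (k : ι → Fin T) :
    n * hellingerSq s μ (F (gridPoint B T k)) f ≤
      excessLoss s (F (gridPoint B T k)) f D / 2 + gridMoment μ f s F B T D +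
        Fintype.card ι * Real.log T := by
  have hT0 : (0 : ℝ) < (T : ℝ) ^ Fintype.card ι := by
    have : (0 : ℝ) < T := by exact_mod_cast hT
    positivity
  set E := n * hellingerSq s μ (F (gridPoint B T k)) f -
      excessLoss s (F (gridPoint B T k)) f D / 2 with hE
  have h1 : Real.exp E ≤ (T : ℝ) ^ Fintype.card ι * gridMoment μ f s F B T D := by
    rw [gridMoment, mul_inv_cancel_left₀ hT0.ne']
    exact Finset.single_le_sum (f := fun k : ι → Fin T =>
      Real.exp (n * hellingerSq s μ (F (gridPoint B T k)) f -
        excessLoss s (F (gridPoint B T k)) f D / 2)) (fun _ _ => (Real.exp_pos _).le)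
      (Finset.mem_univ k)
  have h2 : Real.exp (E - Fintype.card ι * Real.log T) ≤ gridMoment μ f s F B T D := by
    rw [Real.exp_sub, ← Real.log_pow, Real.exp_log hT0, div_le_iff₀ hT0, mul_comm]
    exact h1
  have h3 := Real.add_one_le_exp (E - Fintype.card ι * Real.log T)
  linarith

variable [IsProbabilityMeasure μ]

lemma hellingerSq_le_add {g h f : (Fin s₀ → ℝ) → Fin K → ℝ} (hg : Measurable g)
    (hh : Measurable h) (hf : Measurable f) (hs : 0 < s) (hS : ∀ᵐ x ∂μ, x ∈ S) {c : ℝ}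
    (hc : 0 ≤ c) (hle : ∀ x ∈ S, sqDist (g x) (f x) - sqDist (h x) (f x) ≤ c) :
    hellingerSq s μ g f ≤ hellingerSq s μ h f + c / (8 * (s : ℝ) ^ 2) := by
  have hs0 : (0 : ℝ) < s := by exact_mod_cast hs
  have e : hellingerSq s μ h f + c / (8 * (s : ℝ) ^ 2) =
      ∫ x, ((1 - Real.exp (-sqDist (h x) (f x) / (8 * (s : ℝ) ^ 2))) +
        c / (8 * (s : ℝ) ^ 2)) ∂μ := by
    rw [integral_add (integrable_hellinger_integrand hh hf) (integrable_const _)]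
    simp [hellingerSq]
  rw [e, hellingerSq]
  refine integral_mono_ae (integrable_hellinger_integrand hg hf)
    ((integrable_hellinger_integrand hh hf).add (integrable_const _)) ?_
  filter_upwards [hS] with x hx
  have h1 := exp_neg_sub_exp_neg_le (a := sqDist (h x) (f x) / (8 * (s : ℝ) ^ 2))
    (b := sqDist (g x) (f x) / (8 * (s : ℝ) ^ 2)) (c := c / (8 * (s : ℝ) ^ 2))
    (div_nonneg (sqDist_nonneg _ _) (by positivity)) (by positivity)
    (by rw [← sub_div]; gcongr; exact hle x hx)
  simp only [neg_div]
  linarith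

/-- The discretization step of the grid is so small that both sides of `gridPoint_bound` move by
a bounded amount inside a cell, up to the noise energy and the approximation error. -/
lemma uniform_deviation (hF : Continuous fun p : (ι → ℝ) × (Fin s₀ → ℝ) => F p.1 p.2)
    (hf : Measurable f) (hs : 0 < s) (hB : 0 < B) (hΛ : 1 ≤ Λ) (hn : 1 ≤ n) (hT : 1 ≤ T)
    (hTn : n * Λ ^ 2 * B ≤ T) (hS : ∀ᵐ x ∂μ, x ∈ S)
    (hLip : ∀ w ∈ weightBox ι B, ∀ w' ∈ weightBox ι B, ∀ r : ℝ, 0 ≤ r →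
      (∀ j, |w j - w' j| ≤ r) → ∀ x ∈ S, sqDist (F w x) (F w' x) ≤ Λ ^ 2 * r ^ 2)
    (hw₀ : w₀ ∈ weightBox ι B) (hξ : 0 ≤ ξ) (hξS : ∀ x ∈ S, sqDist (F w₀ x) (f x) ≤ ξ)
    {D : Dataset s₀ K n} (hD : ∀ m, (D m).1 ∈ S) {w : ι → ℝ} (hw : w ∈ weightBox ι B) :
    n * hellingerSq s μ (F w) f ≤ excessLoss s (F w) f D / 2 + gridMoment μ f s F B T D +
      noiseEnergy f D / (s : ℝ) ^ 2 + Fintype.card ι * Real.log T +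
        (2 + 2 * n * ξ + 8 * B ^ 2) / (s : ℝ) ^ 2 := by
  have hs0 : (0 : ℝ) < s := by exact_mod_cast hs
  have hT0 : (0 : ℝ) < T := by exact_mod_cast hT
  have hn1 : (1 : ℝ) ≤ n := by exact_mod_cast hn
  have hn0 : (0 : ℝ) < n := by linarith
  have hΛ0 : 0 < Λ := by linarith
  obtain ⟨k, hk⟩ := exists_gridPoint_near hB hT hw
  set v := gridPoint B T k with hv
  have hvB : v ∈ weightBox ι B := gridPoint_mem hB hT k
  set r := B / T with hr
  have hr0 : 0 < r := by positivity
  have hnr : n * Λ ^ 2 * r ≤ 1 := by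
    rw [hr, ← mul_div_assoc, div_le_one hT0]; exact hTn
  have hFm : ∀ w, Measurable (F w) := fun w =>
    (hF.comp (continuous_const.prodMk continuous_id)).measurable
  -- `a` is the weight in Young's inequality for the cross terms with the approximation error
  set a := (n : ℝ) * Λ ^ 2 with ha
  have ha0 : 0 < a := by positivity
  have hΛ2 : 1 ≤ Λ ^ 2 := one_le_pow₀ hΛ
  have hna : (n : ℝ) ≤ a := by rw [ha]; nlinarith
  have hq : ∀ x ∈ S, a * sqDist (F w x) (F v x) ≤ 1 / n := by
    intro x hx
    calc a * sqDist (F w x) (F v x) ≤ a * (Λ ^ 2 * r ^ 2) := by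
          gcongr; exact hLip w hw v hvB r hr0.le hk x hx
      _ = (n * Λ ^ 2 * r) ^ 2 / n := by rw [ha]; field_simp
      _ ≤ 1 / n := by gcongr; exact pow_le_one₀ (by positivity) hnr
  have hG : ∀ x ∈ S, sqDist (F v x) (f x) / a ≤ (8 * B ^ 2 + 2 * ξ) / n := by
    intro x hx
    have h1 := sqDist_triangle (F v x) (F w₀ x) (f x)
    have h2 := hLip v hvB w₀ hw₀ (2 * B) (by linarith) (fun j => by
      have := abs_sub (v j) (w₀ j)
      linarith [hvB j, hw₀ j]) x hx
    have h3 := hξS x hx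
    rw [div_le_div_iff₀ ha0 hn0]
    have h4 : sqDist (F v x) (f x) ≤ (8 * B ^ 2 + 2 * ξ) * Λ ^ 2 := by nlinarith
    calc sqDist (F v x) (f x) * n ≤ ((8 * B ^ 2 + 2 * ξ) * Λ ^ 2) * n := by gcongr
      _ = (8 * B ^ 2 + 2 * ξ) * a := by rw [ha]; ring
  set c := (2 + 8 * B ^ 2 + 2 * ξ) / n with hc
  have hc0 : 0 ≤ c := by positivity
  have hcsplit : c = 1 / n + 1 / n + (8 * B ^ 2 + 2 * ξ) / n := by rw [hc]; ring
  have hell : hellingerSq s μ (F w) f ≤ hellingerSq s μ (F v) f + c / (8 * (s : ℝ) ^ 2) := by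
    refine hellingerSq_le_add (hFm w) (hFm v) hf hs hS hc0 fun x hx => ?_
    have h1 := sqDist_sub_sqDist_le' (f x) (F w x) (F v x) ha0
    have h2 := hq x hx
    have h3 := hG x hx
    have h4 : sqDist (F w x) (F v x) ≤ a * sqDist (F w x) (F v x) :=
      le_mul_of_one_le_left (sqDist_nonneg _ _) (by linarith)
    linarith
  have hloss : excessLoss s (F v) f D ≤ excessLoss s (F w) f D +
      (noiseEnergy f D + n * c) / (2 * (s : ℝ) ^ 2) := by
    rw [excessLoss, excessLoss, ← add_div]
    gcongr
    rw [← sub_le_iff_le_add', ← Finset.sum_sub_distrib]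
    calc _ ≤ ∑ m, (sqDist (D m).2 (f (D m).1) / n + c) := by
          refine Finset.sum_le_sum fun m _ => ?_
          have h1 := sqDist_sub_sqDist_le (D m).2 (f (D m).1) (F w (D m).1) (F v (D m).1) hn0 ha0
          have h2 := hq _ (hD m)
          have h3 := hG _ (hD m)
          have h4 : (n : ℝ) * sqDist (F w (D m).1) (F v (D m).1) ≤
              a * sqDist (F w (D m).1) (F v (D m).1) := by
            gcongr; exact sqDist_nonneg _ _
          linarith
      _ = noiseEnergy f D + n * c := by
          rw [Finset.sum_add_distrib, noiseEnergy, Finset.sum_div]; simp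
  have hgrid := gridPoint_bound (μ := μ) (f := f) (s := s) (F := F) (B := B) D hT k
  have hnc : n * c = 2 + 8 * B ^ 2 + 2 * ξ := by rw [hc]; field_simp
  have hW := noiseEnergy_nonneg (f := f) D
  rw [hnc] at hloss
  have h5 : n * (hellingerSq s μ (F v) f + c / (8 * (s : ℝ) ^ 2)) =
      n * hellingerSq s μ (F v) f + (2 + 8 * B ^ 2 + 2 * ξ) / (8 * (s : ℝ) ^ 2) := by
    rw [← hnc]; ring
  have h6 := (mul_le_mul_of_nonneg_left hell hn0.le).trans_eq h5
  have h7 : (noiseEnergy f D + (2 + 8 * B ^ 2 + 2 * ξ)) / (2 * (s : ℝ) ^ 2) / 2 +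
      (2 + 8 * B ^ 2 + 2 * ξ) / (8 * (s : ℝ) ^ 2) ≤
      noiseEnergy f D / (s : ℝ) ^ 2 + (2 + 2 * n * ξ + 8 * B ^ 2) / (s : ℝ) ^ 2 := by
    rw [← add_div, show (noiseEnergy f D + (2 + 8 * B ^ 2 + 2 * ξ)) / (2 * (s : ℝ) ^ 2) / 2 +
      (2 + 8 * B ^ 2 + 2 * ξ) / (8 * (s : ℝ) ^ 2) =
      (noiseEnergy f D / 4 + 3 / 8 * (2 + 8 * B ^ 2 + 2 * ξ)) / (s : ℝ) ^ 2 by field_simp; ring]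
    refine div_le_div_of_nonneg_right ?_ (by positivity)
    have : ξ ≤ n * ξ := le_mul_of_one_le_left hξ hn1
    nlinarith [sq_nonneg B]
  linarith

/-- The exponential of the excess loss of `g` minus twice its mean given the covariates. Its
expectation is one. -/
noncomputable def normalizedMoment (f g : (Fin s₀ → ℝ) → Fin K → ℝ) (s : ℝ≥0)
    (D : Dataset s₀ K n) : ℝ :=
  Real.exp (excessLoss s g f D - (∑ m, sqDist (g (D m).1) (f (D m).1)) / (s : ℝ) ^ 2)

end

section
variable {ι : Type} {s₀ K n : ℕ} {f : (Fin s₀ → ℝ) → Fin K → ℝ} {s : ℝ≥0}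
  {F : (ι → ℝ) → (Fin s₀ → ℝ) → Fin K → ℝ} {S : Set (Fin s₀ → ℝ)} {B Λ ξ : ℝ} {w₀ : ι → ℝ} {T : ℕ}

lemma continuous_excessLoss (hF : Continuous fun p : (ι → ℝ) × (Fin s₀ → ℝ) => F p.1 p.2)
    (D : Dataset s₀ K n) : Continuous fun w => excessLoss s (F w) f D := by
  have h : ∀ x k, Continuous fun w => F w x k := fun x k =>
    (continuous_apply k).comp (hF.comp (continuous_id.prodMk continuous_const))
  unfold excessLoss sqDist
  fun_prop

variable [Fintype ι]

/-- The expected loss of a narrow Gaussian around the approximating weights `w₀` is the loss at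
`w₀` up to the Lipschitz constant times the spread. -/
lemma integral_excessLoss_le (hF : Continuous fun p : (ι → ℝ) × (Fin s₀ → ℝ) => F p.1 p.2)
    (hs : 0 < s) (hB : 0 < B) (hΛ : 1 ≤ Λ) (hn : 1 ≤ n) (hT : 1 ≤ T)
    (hTn : n * Λ ^ 2 * B ≤ T)
    (hLip : ∀ w ∈ weightBox ι B, ∀ w' ∈ weightBox ι B, ∀ r : ℝ, 0 ≤ r →
      (∀ j, |w j - w' j| ≤ r) → ∀ x ∈ S, sqDist (F w x) (F w' x) ≤ Λ ^ 2 * r ^ 2)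
    (hw₀ : w₀ ∈ weightBox ι B) (hξ : 0 ≤ ξ) (hξS : ∀ x ∈ S, sqDist (F w₀ x) (f x) ≤ ξ)
    [IsProbabilityMeasure (weightLaw B (w₀, fun _ => Real.toNNReal (B / T) ^ 2))]
    {D : Dataset s₀ K n} (hD : ∀ m, (D m).1 ∈ S) :
    ∫ w, excessLoss s (F w) f D ∂weightLaw B (w₀, fun _ => Real.toNNReal (B / T) ^ 2) ≤
      normalizedMoment f (F w₀) s D + noiseEnergy f D / (s : ℝ) ^ 2 +
        (2 * n * ξ + 8 * Fintype.card ι) / (s : ℝ) ^ 2 := by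
  have hs0 : (0 : ℝ) < s := by exact_mod_cast hs
  have hT0 : (0 : ℝ) < T := by exact_mod_cast hT
  have hT1 : (1 : ℝ) ≤ T := by exact_mod_cast hT
  have hn1 : (1 : ℝ) ≤ n := by exact_mod_cast hn
  have hn0 : (0 : ℝ) < n := by linarith
  have hΛ0 : 0 < Λ := by linarith
  set r := B / T with hr
  have hr0 : 0 < r := by positivity
  have hnr : n * Λ ^ 2 * r ≤ 1 := by
    rw [hr, ← mul_div_assoc, div_le_one hT0]; exact hTn
  set ν := weightLaw B (w₀, fun _ => Real.toNNReal r ^ 2) with hν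
  have hbase : excessLoss s (F w₀) f D ≤ normalizedMoment f (F w₀) s D + n * ξ / (s : ℝ) ^ 2 := by
    have h1 := Real.add_one_le_exp (excessLoss s (F w₀) f D -
      (∑ m, sqDist (F w₀ (D m).1) (f (D m).1)) / (s : ℝ) ^ 2)
    have h2 : (∑ m, sqDist (F w₀ (D m).1) (f (D m).1)) / (s : ℝ) ^ 2 ≤ n * ξ / (s : ℝ) ^ 2 := by
      gcongr
      refine (Finset.sum_le_card_nsmul _ _ ξ fun m _ => hξS _ (hD m)).trans_eq (by simp)
    rw [normalizedMoment]
    linarith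
  set κ := (n + 2) * (n * Λ ^ 2) / (2 * (s : ℝ) ^ 2) with hκ
  have hκ0 : 0 ≤ κ := by positivity
  have hpt : ∀ w ∈ weightBox ι B, excessLoss s (F w) f D ≤
      (normalizedMoment f (F w₀) s D + n * ξ / (s : ℝ) ^ 2 +
        (noiseEnergy f D + n * ξ) / (2 * (s : ℝ) ^ 2)) + κ * ∑ j, (w j - w₀ j) ^ 2 := by
    intro w hw
    have hδ : ∀ x ∈ S, sqDist (F w x) (F w₀ x) ≤ Λ ^ 2 * ∑ j, (w j - w₀ j) ^ 2 := by
      intro x hx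
      have hnn : 0 ≤ ∑ j, (w j - w₀ j) ^ 2 := Finset.sum_nonneg fun _ _ => sq_nonneg _
      have := hLip w hw w₀ hw₀ (√(∑ j, (w j - w₀ j) ^ 2)) (Real.sqrt_nonneg _) (fun j =>
        Real.abs_le_sqrt (Finset.single_le_sum (f := fun j => (w j - w₀ j) ^ 2)
          (fun _ _ => sq_nonneg _) (Finset.mem_univ j))) x hx
      rwa [Real.sq_sqrt hnn] at this
    have hloss : excessLoss s (F w) f D ≤ excessLoss s (F w₀) f D +
        (noiseEnergy f D + n * (ξ + (n + 2) * (Λ ^ 2 * ∑ j, (w j - w₀ j) ^ 2))) /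
          (2 * (s : ℝ) ^ 2) := by
      rw [excessLoss, excessLoss, ← add_div]
      gcongr
      rw [← sub_le_iff_le_add', ← Finset.sum_sub_distrib]
      calc _ ≤ ∑ m, (sqDist (D m).2 (f (D m).1) / n +
            (ξ + (n + 2) * (Λ ^ 2 * ∑ j, (w j - w₀ j) ^ 2))) := by
            refine Finset.sum_le_sum fun m _ => ?_
            have h1 := sqDist_sub_sqDist_le_one (D m).2 (f (D m).1) (F w (D m).1) (F w₀ (D m).1)
              hn0
            have h3 := hξS _ (hD m)
            have h4 := mul_le_mul_of_nonneg_left (hδ _ (hD m)) (by positivity : (0 : ℝ) ≤ n + 2)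
            linarith
        _ = noiseEnergy f D + n * (ξ + (n + 2) * (Λ ^ 2 * ∑ j, (w j - w₀ j) ^ 2)) := by
            rw [Finset.sum_add_distrib, noiseEnergy, Finset.sum_div, Finset.sum_const,
              Finset.card_univ, Fintype.card_fin, nsmul_eq_mul]
    have e : (noiseEnergy f D + n * (ξ + (n + 2) * (Λ ^ 2 * ∑ j, (w j - w₀ j) ^ 2))) /
          (2 * (s : ℝ) ^ 2) = (noiseEnergy f D + n * ξ) / (2 * (s : ℝ) ^ 2) +
          κ * ∑ j, (w j - w₀ j) ^ 2 := by
      rw [hκ]; ring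
    rw [e] at hloss
    linarith
  have hj : ∀ j, Continuous fun w : ι → ℝ => (w j - w₀ j) ^ 2 := fun j => by fun_prop
  have hsecond : ∀ j, ∫ w, (w j - w₀ j) ^ 2 ∂ν ≤ 5 * r ^ 2 := by
    intro j
    rw [integral_eq_lintegral_of_nonneg_ae (Filter.Eventually.of_forall fun _ => sq_nonneg _)
      (hj j).aestronglyMeasurable]
    exact ENNReal.toReal_le_of_le_ofReal (by positivity)
      (lintegral_sq_sub_weightLaw_le hr0 (div_le_self hB.le hT1) hw₀ j)
  set A := normalizedMoment f (F w₀) s D + n * ξ / (s : ℝ) ^ 2 +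
        (noiseEnergy f D + n * ξ) / (2 * (s : ℝ) ^ 2) with hA
  have hκr : κ * r ^ 2 ≤ 3 / (2 * (s : ℝ) ^ 2) := by
    have h1 : (n * Λ ^ 2 * r) ^ 2 ≤ 1 := pow_le_one₀ (by positivity) hnr
    have hΛ2 : 1 ≤ Λ ^ 2 := one_le_pow₀ hΛ
    have h2 : n ^ 2 * Λ ^ 2 * r ^ 2 ≤ 1 := by
      refine le_trans ?_ h1
      rw [show (n * Λ ^ 2 * r) ^ 2 = n ^ 2 * Λ ^ 2 * r ^ 2 * Λ ^ 2 by ring]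
      exact le_mul_of_one_le_right (by positivity) hΛ2
    rw [hκ, div_mul_eq_mul_div]
    gcongr
    calc (n + 2) * (n * Λ ^ 2) * r ^ 2 ≤ (n + 2 * n) * (n * Λ ^ 2) * r ^ 2 := by gcongr; linarith
      _ = 3 * (n ^ 2 * Λ ^ 2 * r ^ 2) := by ring
      _ ≤ 3 := by linarith
  calc ∫ w, excessLoss s (F w) f D ∂ν ≤ ∫ w, (A + κ * ∑ j, (w j - w₀ j) ^ 2) ∂ν :=
        integral_mono_ae (integrable_weightLaw (continuous_excessLoss hF D))
          (integrable_weightLaw (by fun_prop)) ((ae_weightLaw_mem B _).mono hpt)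
    _ = A + κ * ∑ j, ∫ w, (w j - w₀ j) ^ 2 ∂ν := by
        rw [integral_add (integrable_const _) (integrable_weightLaw (by fun_prop)),
          integral_const_mul, integral_finsetSum _ fun j _ => integrable_weightLaw (hj j),
          integral_const, probReal_univ, one_smul]
    _ ≤ A + κ * ∑ _j : ι, 5 * r ^ 2 := by gcongr with j; exact hsecond j
    _ = A + 5 * Fintype.card ι * (κ * r ^ 2) := by
        rw [Finset.sum_const, Finset.card_univ, nsmul_eq_mul]; ring
    _ ≤ A + 5 * Fintype.card ι * (3 / (2 * (s : ℝ) ^ 2)) := by gcongr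
    _ ≤ _ := by
        have hW := noiseEnergy_nonneg (f := f) D
        have e : A + 5 * Fintype.card ι * (3 / (2 * (s : ℝ) ^ 2)) = normalizedMoment f (F w₀) s D +
            (noiseEnergy f D / 2 + 3 / 2 * (n * ξ) + 15 / 2 * Fintype.card ι) / (s : ℝ) ^ 2 := by
          rw [hA]; field_simp; ring
        rw [e, add_assoc (normalizedMoment _ _ _ _), ← add_div]
        refine add_le_add le_rfl (div_le_div_of_nonneg_right ?_ (by positivity))
        have h1 : 0 ≤ n * ξ := by positivity
        have h2 : (0 : ℝ) ≤ Fintype.card ι := Nat.cast_nonneg _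
        linarith

end

section
variable {ι : Type} [Fintype ι] [DecidableEq ι] {s₀ K n : ℕ} {μ : Measure (Fin s₀ → ℝ)}
  {f : (Fin s₀ → ℝ) → Fin K → ℝ} {s : ℝ≥0}
  {F : (ι → ℝ) → (Fin s₀ → ℝ) → Fin K → ℝ} {S : Set (Fin s₀ → ℝ)} {B Λ ξ : ℝ} {w₀ : ι → ℝ} {T : ℕ}

lemma measurable_gridMoment (hF : ∀ w, Measurable (F w)) (hf : Measurable f) :
    Measurable (gridMoment (n := n) μ f s F B T) := by
  have h : ∀ k : ι → Fin T, Measurable fun D : Dataset s₀ K n =>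
      excessLoss s (F (gridPoint B T k)) f D := fun k => measurable_excessLoss (hF _) hf
  unfold gridMoment
  fun_prop

variable [IsProbabilityMeasure μ]

lemma lintegral_gridMoment_le (hF : ∀ w, Measurable (F w)) (hf : Measurable f) (hs : 0 < s)
    (hT : 1 ≤ T) :
    ∫⁻ D, ENNReal.ofReal (gridMoment μ f s F B T D) ∂dataLaw n μ f s ≤ 1 := by
  have hT0 : (0 : ℝ) < (T : ℝ) ^ Fintype.card ι := by
    have : (0 : ℝ) < T := by exact_mod_cast hT
    positivity
  have h : ∀ k : ι → Fin T, Measurable fun D : Dataset s₀ K n =>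
      excessLoss s (F (gridPoint B T k)) f D := fun k => measurable_excessLoss (hF _) hf
  simp only [gridMoment, ENNReal.ofReal_mul (inv_pos.2 hT0).le,
    ENNReal.ofReal_sum_of_nonneg fun (k : ι → Fin T) (_ : k ∈ Finset.univ) =>
      (Real.exp_pos (n * hellingerSq s μ (F (gridPoint B T k)) f -
        excessLoss s (F (gridPoint B T k)) f _ / 2)).le]
  rw [lintegral_const_mul _ (by fun_prop), lintegral_finsetSum _ fun k _ => by fun_prop]
  calc _ ≤ ENNReal.ofReal ((T : ℝ) ^ Fintype.card ι)⁻¹ * ∑ _k : ι → Fin T, 1 := by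
        gcongr with k
        exact lintegral_exp_neg_half_excessLoss_le hs (hF _) hf
    _ = ENNReal.ofReal ((T : ℝ) ^ Fintype.card ι)⁻¹ * ENNReal.ofReal ((T : ℝ) ^ Fintype.card ι) := by
        congr 1
        rw [Finset.sum_const, Finset.card_univ, Fintype.card_fun, Fintype.card_fin, nsmul_one,
          ← Nat.cast_pow, ENNReal.ofReal_natCast]
    _ = 1 := by
        rw [← ENNReal.ofReal_mul (inv_pos.2 hT0).le, inv_mul_cancel₀ hT0.ne', ENNReal.ofReal_one]

/-- A single random variable with small expectation controls both the deviations that are uniform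
over the box and the loss of the comparison posterior. -/
lemma exists_deviation_bound (hF : Continuous fun p : (ι → ℝ) × (Fin s₀ → ℝ) => F p.1 p.2)
    (hf : Measurable f) (hs : 0 < s) (hB : 0 < B) (hΛ : 1 ≤ Λ) (hn : 1 ≤ n) (hT : 1 ≤ T)
    (hTn : n * Λ ^ 2 * B ≤ T) (hS : ∀ᵐ x ∂μ, x ∈ S)
    (hLip : ∀ w ∈ weightBox ι B, ∀ w' ∈ weightBox ι B, ∀ r : ℝ, 0 ≤ r →
      (∀ j, |w j - w' j| ≤ r) → ∀ x ∈ S, sqDist (F w x) (F w' x) ≤ Λ ^ 2 * r ^ 2)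
    (hw₀ : w₀ ∈ weightBox ι B) (hξ : 0 ≤ ξ) (hξS : ∀ x ∈ S, sqDist (F w₀ x) (f x) ≤ ξ)
    [IsProbabilityMeasure (weightLaw B (w₀, fun _ => Real.toNNReal (B / T) ^ 2))] :
    ∃ V : Dataset s₀ K n → ℝ, Measurable V ∧ (∀ D, 0 ≤ V D) ∧
      ∫⁻ D, ENNReal.ofReal (V D) ∂dataLaw n μ f s ≤ ENNReal.ofReal (2 + K) ∧
      ∀ D : Dataset s₀ K n, (∀ m, (D m).1 ∈ S) →
        (∀ φ : GaussParam ι, IsProbabilityMeasure (weightLaw B φ) →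
          n * ∫ w, hellingerSq s μ (F w) f ∂weightLaw B φ ≤
            (∫ w, excessLoss s (F w) f D ∂weightLaw B φ) / 2 + V D +
              Fintype.card ι * Real.log T + (2 + 2 * n * ξ + 8 * B ^ 2) / (s : ℝ) ^ 2) ∧
        ∫ w, excessLoss s (F w) f D ∂weightLaw B (w₀, fun _ => Real.toNNReal (B / T) ^ 2) ≤
          V D + (2 * n * ξ + 8 * Fintype.card ι) / (s : ℝ) ^ 2 := by
  have hs0 : (0 : ℝ) < s := by exact_mod_cast hs
  have hn0 : (0 : ℝ) < n := by exact_mod_cast hn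
  have hFm : ∀ w, Measurable (F w) := fun w =>
    (hF.comp (continuous_const.prodMk continuous_id)).measurable
  have hgm : Measurable (gridMoment (n := n) μ f s F B T) := measurable_gridMoment hFm hf
  have hg0 : ∀ D : Dataset s₀ K n, 0 ≤ gridMoment μ f s F B T D := fun D =>
    mul_nonneg (by positivity) (Finset.sum_nonneg fun _ _ => (Real.exp_pos _).le)
  have hF₀ := hFm w₀
  have hcm : Measurable (normalizedMoment (n := n) f (F w₀) s) := by
    have := measurable_excessLoss (n := n) (s := s) hF₀ hf
    unfold normalizedMoment
    fun_prop
  have hc0 : ∀ D : Dataset s₀ K n, 0 ≤ normalizedMoment f (F w₀) s D := fun D => (Real.exp_pos _).le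
  have hwm : Measurable (noiseEnergy (n := n) f) := by
    unfold noiseEnergy
    fun_prop
  refine ⟨fun D => gridMoment μ f s F B T D + normalizedMoment f (F w₀) s D +
    noiseEnergy f D / (s : ℝ) ^ 2, by fun_prop, fun D => ?_, ?_, fun D hD => ⟨fun φ _ => ?_, ?_⟩⟩
  · have := noiseEnergy_nonneg (f := f) D
    have := hg0 D
    have := hc0 D
    positivity
  · have e : ∀ D : Dataset s₀ K n, ENNReal.ofReal (gridMoment μ f s F B T D +
        normalizedMoment f (F w₀) s D + noiseEnergy f D / (s : ℝ) ^ 2) =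
        ENNReal.ofReal (gridMoment μ f s F B T D) +
        ENNReal.ofReal (normalizedMoment f (F w₀) s D) + ENNReal.ofReal (n * (s : ℝ) ^ 2)⁻¹ *
          ENNReal.ofReal (∑ m, sqDist (D m).2 (f (D m).1)) := by
      intro D
      rw [ENNReal.ofReal_add (add_nonneg (hg0 D) (hc0 D))
        (div_nonneg (noiseEnergy_nonneg D) (by positivity)), ENNReal.ofReal_add (hg0 D) (hc0 D),
        ← ENNReal.ofReal_mul (by positivity)]
      congr 2
      rw [noiseEnergy]
      field_simp
    simp only [e]
    rw [lintegral_add_left (by fun_prop), lintegral_add_left (by fun_prop),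
      lintegral_const_mul _ (by fun_prop), lintegral_sum_sqDist_dataLaw hf,
      ← ENNReal.ofReal_mul (by positivity)]
    have e2 : ((n : ℝ) * (s : ℝ) ^ 2)⁻¹ * (n * (K * (s : ℝ) ^ 2)) = K := by field_simp
    rw [e2, ENNReal.ofReal_add (by norm_num) (Nat.cast_nonneg K)]
    gcongr
    calc _ ≤ (1 : ℝ≥0∞) + 1 :=
          add_le_add (lintegral_gridMoment_le hFm hf hs hT) (lintegral_exp_excessLoss hs hF₀ hf).le
      _ = ENNReal.ofReal 2 := by rw [one_add_one_eq_two]; simp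
  · have hint := integrable_weightLaw (a := φ) (B := B) (continuous_excessLoss (s := s) (f := f) hF D)
    set c := gridMoment μ f s F B T D + noiseEnergy f D / (s : ℝ) ^ 2 +
      Fintype.card ι * Real.log T + (2 + 2 * n * ξ + 8 * B ^ 2) / (s : ℝ) ^ 2 with hc
    have h1 : ∫ w, n * hellingerSq s μ (F w) f ∂weightLaw B φ ≤
        ∫ w, (excessLoss s (F w) f D / 2 + c) ∂weightLaw B φ := by
      refine integral_mono_of_nonneg (Filter.Eventually.of_forall fun w => ?_)
        ((hint.div_const 2).add (integrable_const c)) ?_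
      · refine mul_nonneg hn0.le (integral_nonneg fun x => ?_)
        rw [Pi.zero_apply, sub_nonneg, Real.exp_le_one_iff, neg_div, neg_nonpos]
        exact div_nonneg (sqDist_nonneg _ _) (by positivity)
      · filter_upwards [ae_weightLaw_mem B φ] with w hw
        have := uniform_deviation hF hf hs hB hΛ hn hT hTn hS hLip hw₀ hξ hξS hD hw
        rw [hc]
        linarith
    rw [integral_const_mul, integral_add (hint.div_const 2) (integrable_const c), integral_div,
      integral_const, probReal_univ, one_smul] at h1
    have := hc0 D
    rw [hc] at h1
    linarith
  · have := integral_excessLoss_le hF hs hB hΛ hn hT hTn hLip hw₀ hξ hξS hD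
    have := hg0 D
    linarith

end

/-! ### Optimality -/

lemma IsParamSet.isotropic_div_mem {ι : Type} [Fintype ι] {B : ℝ} {A : Set (GaussParam ι)}
    (hA : IsParamSet B A) (hB : 0 < B) {T : ℝ} (hT : 1 ≤ T) {m : ι → ℝ} (hm : m ∈ weightBox ι B) :
    ((m, fun _ => Real.toNNReal (B / T) ^ 2) : GaussParam ι) ∈ A := by
  have ht : 0 < B / T := by positivity
  refine hA.isotropic_mem _ hm _ (by positivity) ?_
  rw [NNReal.coe_pow, Real.coe_toNNReal _ ht.le]
  exact pow_le_pow_left₀ ht.le (div_le_self hB.le hT) 2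

lemma ereal_coe_sum {α : Type*} (t : Finset α) (g : α → ℝ) :
    ((∑ i ∈ t, g i : ℝ) : EReal) = ∑ i ∈ t, (g i : EReal) :=
  map_sum (⟨⟨Real.toEReal, EReal.coe_zero⟩, EReal.coe_add⟩ : ℝ →+ EReal) g t

/-- An optimal solution does at least as well as a common centred prior with standard deviation `B`
and local posteriors that concentrate around any prescribed weights. -/
lemma IsOptimal.sum_integral_le {s₀ M L K n N : ℕ} {σ : ℝ → ℝ} {B : ℝ} {s : ℝ≥0}
    {Θ Φ : Set (GaussParam (WeightIndex s₀ M L K))} {D : Fin N → Dataset s₀ K n}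
    {θ : GaussParam (WeightIndex s₀ M L K)} {φ : Fin N → GaussParam (WeightIndex s₀ M L K)}
    (h : IsOptimal σ B s Θ Φ D θ φ) (hΘ : IsParamSet B Θ) (hΦ : IsParamSet B Φ) (hN : 1 ≤ N)
    (hB : 0 < B) {T : ℕ} (hT : 1 ≤ T) {w₀ : Fin N → WeightIndex s₀ M L K → ℝ}
    (hw₀ : ∀ i, w₀ i ∈ weightBox _ B) :
    ∑ i, ∫ w, negLogLik s (network σ w) (D i) ∂weightLaw B (φ i) ≤
      ∑ i, (∫ w, negLogLik s (network σ w) (D i)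
        ∂weightLaw B (w₀ i, fun _ => Real.toNNReal (B / T) ^ 2) +
          (numParams s₀ M L K * Real.log (10 * T) + 1)) := by
  obtain ⟨⟨-, hθ⟩, hφ⟩ := h
  have hT1 : (1 : ℝ) ≤ T := by exact_mod_cast hT
  have hN0 : (0 : ℝ) < N := by exact_mod_cast hN
  set θ' : GaussParam (WeightIndex s₀ M L K) := ((fun _ => 0), fun _ => Real.toNNReal B ^ 2)
  have hθ' : θ' ∈ Θ := by
    refine hΘ.isotropic_mem _ (fun j => by simpa using hB.le) _ (by positivity) ?_
    simp [Real.coe_toNNReal _ hB.le]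
  have hφ' := fun i => hΦ.isotropic_div_mem hB hT1 (hw₀ i)
  have hlow : ((∑ i, ∫ w, negLogLik s (network σ w) (D i) ∂weightLaw B (φ i) : ℝ) : EReal) ≤
      ∑ i, ⨅ φ ∈ Φ, localObjective σ B s (D i) θ φ := by
    rw [ereal_coe_sum]
    refine Finset.sum_le_sum fun i _ => le_iInf₂ fun φ' hφ' => ?_
    refine le_trans ?_ ((hφ i).2 φ' hφ')
    rw [localObjective]
    exact le_add_of_nonneg_right (EReal.coe_ennreal_nonneg _)
  have hup : ∑ i, ⨅ φ ∈ Φ, localObjective σ B s (D i) θ' φ ≤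
      ((∑ i, (∫ w, negLogLik s (network σ w) (D i)
        ∂weightLaw B (w₀ i, fun _ => Real.toNNReal (B / T) ^ 2) +
          (numParams s₀ M L K * Real.log (10 * T) + 1)) : ℝ) : EReal) := by
    rw [ereal_coe_sum]
    refine Finset.sum_le_sum fun i _ => (iInf₂_le _ (hφ' i)).trans ?_
    rw [localObjective, EReal.coe_add]
    refine add_le_add le_rfl ?_
    have hlog : 0 ≤ Real.log (10 * T) := Real.log_nonneg (by linarith)
    have h1 := klDiv_weightLaw_le hB hT1 (hw₀ i)
    have h2 := EReal.coe_ennreal_le_coe_ennreal_iff.2 h1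
    refine h2.trans (le_of_eq ?_)
    rw [EReal.coe_ennreal_ofReal, max_eq_left (by positivity)]
    rfl
  have hfed := hθ θ' hθ'
  rw [fedObjective, fedObjective] at hfed
  have hc : (0 : EReal) ≤ (((N : ℝ)⁻¹ : ℝ) : EReal) := by
    exact_mod_cast (inv_pos.2 hN0).le
  have h3 := ((mul_le_mul_of_nonneg_left hlow hc).trans hfed).trans
    (mul_le_mul_of_nonneg_left hup hc)
  rw [← EReal.coe_mul, ← EReal.coe_mul, EReal.coe_le_coe_iff] at h3
  exact le_of_mul_le_mul_left h3 (inv_pos.2 hN0)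

/-! ### The rates -/

lemma numParams_eq (s₀ M L K : ℕ) :
    numParams s₀ M L K = M * (s₀ + 1) + ((L - 1) * (M * (M + 1)) + K * (M + 1)) := by
  simp [numParams]

section
variable {s₀ M L K n : ℕ}

lemma le_mul_rate (hM : 2 ≤ M) (hK : 1 ≤ K) (hn : 1 ≤ n)
    (hd : (numParams s₀ M L K : ℝ) ≤ (s₀ : ℝ) ^ 2 * n) :
    (L + 1) * (numParams s₀ M L K : ℝ) * Real.log M ≤ n * rate s₀ M L K n := by
  have hn0 : (0 : ℝ) < n := by exact_mod_cast hn
  have hs : (0 : ℝ) ≤ s₀ := Nat.cast_nonneg _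
  have hd0 : (0 : ℝ) < numParams s₀ M L K := by
    rw [numParams_eq]
    have : 0 < K * (M + 1) := by positivity
    exact_mod_cast (by omega)
  have hlog : 0 ≤ Real.log (s₀ * √(n / numParams s₀ M L K)) := by
    refine Real.log_nonneg ?_
    rw [← Real.sqrt_sq hs, ← Real.sqrt_mul (sq_nonneg _), Real.one_le_sqrt, ← mul_div_assoc,
      one_le_div hd0]
    exact hd
  have e : n * rate s₀ M L K n = (L + 1) * (numParams s₀ M L K : ℝ) * Real.log M +
      numParams s₀ M L K * Real.log (s₀ * √(n / numParams s₀ M L K)) := by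
    simp only [rate]
    field_simp
  rw [e]
  exact le_add_of_nonneg_right (mul_nonneg hd0.le hlog)

lemma half_le_log {M : ℕ} (hM : 2 ≤ M) : 1 / 2 ≤ Real.log M := by
  have h1 : Real.log 2 ≤ Real.log M :=
    Real.log_le_log (by norm_num) (by exact_mod_cast hM)
  linarith [Real.log_two_gt_d9]

lemma add_one_mul_numParams_le (hM : 2 ≤ M) (hK : 1 ≤ K) (hn : 1 ≤ n)
    (hd : (numParams s₀ M L K : ℝ) ≤ (s₀ : ℝ) ^ 2 * n) :
    (L + 1) * (numParams s₀ M L K : ℝ) ≤ 2 * (n * rate s₀ M L K n) := by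
  have h1 := le_mul_rate hM hK hn hd
  have h2 := half_le_log hM
  have h3 : 0 ≤ (L + 1) * (numParams s₀ M L K : ℝ) := by positivity
  nlinarith

lemma numParams_le (hM : 2 ≤ M) (hL : 1 ≤ L) (hK : 1 ≤ K) (hn : 1 ≤ n)
    (hd : (numParams s₀ M L K : ℝ) ≤ (s₀ : ℝ) ^ 2 * n) :
    (numParams s₀ M L K : ℝ) ≤ n * rate s₀ M L K n := by
  have h1 := add_one_mul_numParams_le (L := L) hM hK hn hd
  have hL1 : (1 : ℝ) ≤ L := by exact_mod_cast hL
  have h3 : 0 ≤ (numParams s₀ M L K : ℝ) := by positivity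
  nlinarith

/-- The resolution `T` at which the networks are discretized makes the entropy of the grid of order
`n r_n log n`: only the width and depth enter exponentially in the Lipschitz constant, the other
dimensions are at most the number `d ≤ n` of parameters. -/
lemma mul_log_resolution_le {σ : ℝ → ℝ} {B R : ℝ} (hB : 0 < B) (hs₀ : 1 ≤ s₀) (hM : 2 ≤ M)
    (hL : 1 ≤ L) (hK : 1 ≤ K) (hn : 1 ≤ Real.log n)
    (hd : (numParams s₀ M L K : ℝ) ≤ (s₀ : ℝ) ^ 2 * n) (hdn : (numParams s₀ M L K : ℝ) ≤ n)
    {T : ℝ} (hT : 1 ≤ T) (hT2 : T ≤ n * networkLip σ B R s₀ M L K ^ 2 * B + 2) :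
    numParams s₀ M L K * Real.log (10 * T) ≤ n * rate s₀ M L K n *
      ((Real.log (10 * (B + 2)) + 4 * Real.log (layerGrowth σ B R) + 7) * Real.log n) := by
  set G := layerGrowth σ B R with hGdef
  have hG1 : 1 ≤ G := one_le_layerGrowth σ hB R
  set d : ℝ := (numParams s₀ M L K : ℝ) with hddef
  have hd0 : 0 ≤ d := Nat.cast_nonneg _
  have hn1 : 1 ≤ n := by
    rcases Nat.eq_zero_or_pos n with h | h
    · rw [h] at hn; norm_num at hn
    · exact h
  have hnr : (1 : ℝ) ≤ n := by exact_mod_cast hn1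
  have hMr : (1 : ℝ) ≤ M := by exact_mod_cast (by omega : 1 ≤ M)
  have hKr : (1 : ℝ) ≤ K := by exact_mod_cast hK
  have hsr : (1 : ℝ) ≤ s₀ := by exact_mod_cast hs₀
  have hKd : (K : ℝ) ≤ n := by
    refine le_trans ?_ hdn
    rw [hddef, numParams_eq]
    exact_mod_cast (by nlinarith [Nat.zero_le ((L - 1) * (M * (M + 1)))] :
      K ≤ M * (s₀ + 1) + ((L - 1) * (M * (M + 1)) + K * (M + 1)))
  have hsd : (s₀ : ℝ) ≤ n := by
    refine le_trans ?_ hdn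
    rw [hddef, numParams_eq]
    exact_mod_cast (by nlinarith [Nat.zero_le ((L - 1) * (M * (M + 1)) + K * (M + 1))] :
      s₀ ≤ M * (s₀ + 1) + ((L - 1) * (M * (M + 1)) + K * (M + 1)))
  have hΛ : 1 ≤ networkLip σ B R s₀ M L K := one_le_networkLip σ hB R hs₀ (by omega) hK
  have hlogΛ : Real.log (networkLip σ B R s₀ M L K) ≤
      2 * Real.log n + (L + 1) * (Real.log G + Real.log M) := by
    rw [networkLip, ← hGdef, Real.log_mul (by positivity) (by positivity),
      Real.log_mul (by positivity) (by positivity), Real.log_pow,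
      Real.log_mul (by positivity) (by positivity), Real.log_mul (by positivity) (by positivity)]
    have h1 := Real.log_le_log (by linarith) hKd
    have h2 := Real.log_le_log (by linarith) hsd
    have h3 := Real.log_nonneg hMr
    linarith
  have hlogT : Real.log (10 * T) ≤ Real.log (10 * (B + 2)) + Real.log n +
      2 * Real.log (networkLip σ B R s₀ M L K) := by
    have h1 : 10 * T ≤ 10 * (B + 2) * n * networkLip σ B R s₀ M L K ^ 2 := by
      have : 1 ≤ n * networkLip σ B R s₀ M L K ^ 2 :=
        one_le_mul_of_one_le_of_one_le hnr (one_le_pow₀ hΛ)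
      nlinarith
    refine (Real.log_le_log (by linarith) h1).trans_eq ?_
    rw [Real.log_mul (by positivity) (by positivity), Real.log_mul (by positivity) (by positivity),
      Real.log_pow]
    norm_num
  have h1 : (L + 1) * d * Real.log M ≤ n * rate s₀ M L K n := le_mul_rate hM hK hn1 hd
  have h2 : (L + 1) * d ≤ 2 * (n * rate s₀ M L K n) := add_one_mul_numParams_le hM hK hn1 hd
  have h3 : d ≤ n * rate s₀ M L K n := numParams_le hM hL hK hn1 hd
  set ρ := n * rate s₀ M L K n
  have hρ : 0 ≤ ρ := hd0.trans h3
  have hlG := Real.log_nonneg hG1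
  have hlB : 0 ≤ Real.log (10 * (B + 2)) := Real.log_nonneg (by linarith)
  calc d * Real.log (10 * T)
      ≤ d * (Real.log (10 * (B + 2)) + 5 * Real.log n +
          2 * ((L + 1) * (Real.log G + Real.log M))) := by gcongr; linarith
    _ = d * (Real.log (10 * (B + 2)) + 5 * Real.log n) + (2 * Real.log G) * ((L + 1) * d) +
          2 * ((L + 1) * d * Real.log M) := by ring
    _ ≤ ρ * (Real.log (10 * (B + 2)) + 5 * Real.log n) + (2 * Real.log G) * (2 * ρ) + 2 * ρ := by
        gcongr
    _ = ρ * ((Real.log (10 * (B + 2)) + 4 * Real.log G + 2) * 1 + 5 * Real.log n) := by ring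
    _ ≤ ρ * ((Real.log (10 * (B + 2)) + 4 * Real.log G + 2) * Real.log n + 5 * Real.log n) := by
        gcongr
    _ = _ := by ring

end

/-! ### Comparison with the approximating networks -/

lemma hellingerSq_le_one {s₀ K : ℕ} (s : ℝ≥0) (μ : Measure (Fin s₀ → ℝ)) [IsProbabilityMeasure μ]
    (g f : (Fin s₀ → ℝ) → Fin K → ℝ) : hellingerSq s μ g f ≤ 1 := by
  have h : ∀ x, 0 ≤ 1 - Real.exp (-sqDist (g x) (f x) / (8 * (s : ℝ) ^ 2)) := fun x => by
    rw [sub_nonneg, Real.exp_le_one_iff, neg_div, neg_nonpos]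
    exact div_nonneg (sqDist_nonneg _ _) (by positivity)
  calc hellingerSq s μ g f ≤ ∫ _, (1 : ℝ) ∂μ := by
        refine integral_mono_of_nonneg (Filter.Eventually.of_forall h) (integrable_const _)
          (Filter.Eventually.of_forall fun x => ?_)
        have := Real.exp_pos (-sqDist (g x) (f x) / (8 * (s : ℝ) ^ 2))
        simp only
        linarith
    _ = 1 := by simp

lemma hellingerSq_nonneg {s₀ K : ℕ} (s : ℝ≥0) (μ : Measure (Fin s₀ → ℝ))
    (g f : (Fin s₀ → ℝ) → Fin K → ℝ) : 0 ≤ hellingerSq s μ g f := by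
  refine integral_nonneg fun x => ?_
  rw [Pi.zero_apply, sub_nonneg, Real.exp_le_one_iff, neg_div, neg_nonpos]
  exact div_nonneg (sqDist_nonneg _ _) (by positivity)

lemma exists_near_optimal_weights {s₀ K M L : ℕ} {σ : ℝ → ℝ} {B : ℝ} {S : Set (Fin s₀ → ℝ)}
    {f : (Fin s₀ → ℝ) → Fin K → ℝ} (h : approxError M L σ B S f ≠ ∞) {ρ : ℝ} (hρ : 0 < ρ) :
    ∃ w ∈ weightBox (WeightIndex s₀ M L K) B,
      ∀ x ∈ S, sqDist (network σ w x) (f x) ≤ (approxError M L σ B S f).toReal + ρ := by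
  have h1 : approxError M L σ B S f < approxError M L σ B S f + ENNReal.ofReal ρ :=
    ENNReal.lt_add_right h (by simpa using hρ)
  conv_lhs at h1 => rw [approxError]
  obtain ⟨w, hw, hlt⟩ := (by simpa only [iInf_lt_iff, exists_prop] using h1 :
    ∃ w ∈ weightBox (WeightIndex s₀ M L K) B,
      ⨆ x ∈ S, ENNReal.ofReal (sqDist (network σ w x) (f x)) <
        approxError M L σ B S f + ENNReal.ofReal ρ)
  refine ⟨w, hw, fun x hx => ?_⟩
  have h2 := (le_iSup₂ (f := fun x (_ : x ∈ S) => ENNReal.ofReal (sqDist (network σ w x) (f x)))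
    x hx).trans hlt.le
  rw [← ENNReal.ofReal_toReal h, ← ENNReal.ofReal_add ENNReal.toReal_nonneg hρ.le] at h2
  exact (ENNReal.ofReal_le_ofReal_iff (by positivity)).1 h2

/-- If each risk `a i` is controlled by half the excess loss of the optimal local posterior, then
optimality replaces that loss by the loss of the comparison posterior plus its divergence from the
comparison prior. -/
lemma sum_hellinger_le {s₀ M L K n N : ℕ} {σ : ℝ → ℝ} (hσ : Continuous σ) {B : ℝ} {s : ℝ≥0}
    (hs : 0 < s) {Θ Φ : Set (GaussParam (WeightIndex s₀ M L K))} {D : Fin N → Dataset s₀ K n}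
    {θ : GaussParam (WeightIndex s₀ M L K)} {φ : Fin N → GaussParam (WeightIndex s₀ M L K)}
    (hopt : IsOptimal σ B s Θ Φ D θ φ) (hΘ : IsParamSet B Θ) (hΦ : IsParamSet B Φ) (hN : 1 ≤ N)
    (hB : 0 < B) {T : ℕ} (hT : 1 ≤ T) {w₀ : Fin N → WeightIndex s₀ M L K → ℝ}
    (hw₀ : ∀ i, w₀ i ∈ weightBox _ B) {f : Fin N → (Fin s₀ → ℝ) → Fin K → ℝ}
    {a V c c' : Fin N → ℝ}
    (h1 : ∀ i, a i ≤ (∫ w, excessLoss s (network σ w) (f i) (D i) ∂weightLaw B (φ i)) / 2 +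
      V i + c i)
    (h2 : ∀ i, ∫ w, excessLoss s (network σ w) (f i) (D i)
        ∂weightLaw B (w₀ i, fun _ => Real.toNNReal (B / T) ^ 2) ≤ V i + c' i) :
    ∑ i, a i ≤ ∑ i, (3 / 2 * V i + c i +
      (c' i + numParams s₀ M L K * Real.log (10 * T) + 1) / 2) := by
  have hT1 : (1 : ℝ) ≤ T := by exact_mod_cast hT
  have hp' : ∀ i, IsProbabilityMeasure (weightLaw B (w₀ i, fun _ => Real.toNNReal (B / T) ^ 2)) :=
    fun i => isProbabilityMeasure_weightLaw (hΦ.charges _ (hΦ.isotropic_div_mem hB hT1 (hw₀ i)))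
  have hp : ∀ i, IsProbabilityMeasure (weightLaw B (φ i)) := fun i =>
    isProbabilityMeasure_weightLaw (hΦ.charges _ (hopt.2 i).1)
  have hsplit : ∀ i (a : GaussParam (WeightIndex s₀ M L K)), IsProbabilityMeasure (weightLaw B a) →
      ∫ w, negLogLik s (network σ w) (D i) ∂weightLaw B a = negLogLik s (f i) (D i) +
        ∫ w, excessLoss s (network σ w) (f i) (D i) ∂weightLaw B a := by
    intro i a ha
    simp only [negLogLik_sub hs (network σ _) (f i) (D i)]
    rw [integral_add (integrable_const _) (integrable_weightLaw
      (continuous_excessLoss (continuous_network hσ) _)), integral_const, probReal_univ, one_smul]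
  have key := hopt.sum_integral_le hΘ hΦ hN hB hT hw₀
  simp only [hsplit _ _ (hp _), hsplit _ _ (hp' _), add_assoc, Finset.sum_add_distrib] at key
  have h3 := Finset.sum_le_sum fun i (_ : i ∈ Finset.univ) => h1 i
  have h4 := Finset.sum_le_sum fun i (_ : i ∈ Finset.univ) => h2 i
  simp only [Finset.sum_add_distrib, ← Finset.sum_div, ← Finset.mul_sum] at h3 h4 key ⊢
  linarith

/-- Arithmetic behind the rate: the per-client bounds are all of order `n ρ ℓ`, where `ρ` is the
rate and `ℓ = log n`, apart from the approximation errors `ξ i`. -/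
lemma average_le_of_sum_le {N : ℕ} {n ρ ℓ d k b b' B v η c₀ H : ℝ} {V ξ : Fin N → ℝ}
    (hN : (0 : ℝ) < N) (hn : 0 < n) (hρ : 0 < ρ) (hℓ : 1 ≤ ℓ) (hd1 : 1 ≤ d) (hd : d ≤ n * ρ)
    (hk : k ≤ d) (hb : d * b ≤ d * b') (hb' : d * b' ≤ n * ρ * (c₀ * ℓ)) (hc₀ : 0 ≤ c₀)
    (hv : 0 < v) (hη : 0 < η) (hV : ∑ i, V i ≤ N * (2 + k) / η)
    (hsum : n * H ≤ ∑ i, (3 / 2 * V i + (d * b + (2 + 2 * n * (ξ i + ρ) + 8 * B ^ 2) / v) +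
      ((2 * n * (ξ i + ρ) + 8 * d) / v + d * b' + 1) / 2)) :
    (N : ℝ)⁻¹ * H ≤ ρ * ((9 / 2 / η + (2 * c₀ + 1 + (6 + 8 * B ^ 2 + 3) / v)) * ℓ) +
      3 / v * ((N : ℝ)⁻¹ * ∑ i, ξ i) := by
  set c₁ := 2 * c₀ + 1 + (6 + 8 * B ^ 2 + 3) / v with hc₁
  have hρℓ : n * ρ ≤ n * ρ * ℓ := le_mul_of_one_le_right (by positivity) hℓ
  have hterm : ∀ i, 3 / 2 * V i + (d * b + (2 + 2 * n * (ξ i + ρ) + 8 * B ^ 2) / v) +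
      ((2 * n * (ξ i + ρ) + 8 * d) / v + d * b' + 1) / 2 ≤
      3 / 2 * V i + n * (3 / v * ξ i) + n * ρ * (c₁ * ℓ) := by
    intro i
    have e : n * ρ * (c₁ * ℓ) = 2 * (n * ρ * (c₀ * ℓ)) + n * ρ * ℓ +
        ((6 + 8 * B ^ 2) * (n * ρ * ℓ) + 3 * (n * ρ * ℓ)) / v := by
      rw [hc₁]; ring
    have e2 : (2 + 2 * n * (ξ i + ρ) + 8 * B ^ 2) / v + (2 * n * (ξ i + ρ) + 8 * d) / v / 2 =
        n * (3 / v * ξ i) + (2 + 8 * B ^ 2 + 4 * d + 3 * (n * ρ)) / v := by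
      ring
    have h3 : (2 + 8 * B ^ 2 + 4 * d + 3 * (n * ρ)) / v ≤
        ((6 + 8 * B ^ 2) * (n * ρ * ℓ) + 3 * (n * ρ * ℓ)) / v := by
      refine div_le_div_of_nonneg_right ?_ hv.le
      have h5 : 8 * B ^ 2 ≤ 8 * B ^ 2 * (n * ρ * ℓ) :=
        le_mul_of_one_le_right (by positivity) (by linarith)
      linarith
    have hX : 0 ≤ n * ρ * (c₀ * ℓ) := by positivity
    rw [e]
    linarith
  have hsum2 := hsum.trans (Finset.sum_le_sum fun i _ => hterm i)
  rw [Finset.sum_add_distrib, Finset.sum_add_distrib, ← Finset.mul_sum, ← Finset.mul_sum,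
    ← Finset.mul_sum, Finset.sum_const, Finset.card_univ, Fintype.card_fin, nsmul_eq_mul] at hsum2
  have hV2 : 3 / 2 * ∑ i, V i ≤ N * (n * ρ * (9 / 2 / η * ℓ)) := by
    have h1 : 2 + k ≤ 3 * (n * ρ * ℓ) := by linarith
    calc 3 / 2 * ∑ i, V i ≤ 3 / 2 * (N * (2 + k) / η) := by gcongr
      _ = N * (3 / 2 / η * (2 + k)) := by ring
      _ ≤ N * (3 / 2 / η * (3 * (n * ρ * ℓ))) := by gcongr
      _ = _ := by ring
  have h1 : n * H ≤ n * (N * (ρ * ((9 / 2 / η + c₁) * ℓ)) + 3 / v * ∑ i, ξ i) := by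
    refine hsum2.trans (le_trans (add_le_add (add_le_add hV2 le_rfl) le_rfl) (le_of_eq ?_))
    ring
  have h2 := le_of_mul_le_mul_left h1 hn
  calc (N : ℝ)⁻¹ * H ≤ (N : ℝ)⁻¹ * (N * (ρ * ((9 / 2 / η + c₁) * ℓ)) + 3 / v * ∑ i, ξ i) := by
        gcongr
    _ = _ := by field_simp

end FedELBO

open FedELBO in
theorem theorem1
    -- activation, weight bound, noise level, exponent of the logarithm, size of the covariates
    (σ : ℝ → ℝ) (hσ : LipschitzWith 1 σ) (B : ℝ) (hB : 0 < B) (s : ℝ≥0) (hs : 0 < s)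
    (δ : ℝ) (hδ : 1 < δ) (R : ℝ) :
    ∃ C C' C'' : ℝ, 0 < C ∧ 0 < C' ∧ 0 < C'' ∧
      -- with probability tending to one, uniformly in everything below
      ∀ η : ℝ, 0 < η → ∃ n₀ : ℕ, ∀ n : ℕ, n₀ ≤ n →
      -- architecture
      ∀ s₀ M L K : ℕ, 1 ≤ s₀ → 2 ≤ M → 1 ≤ L → 1 ≤ K →
      (FedELBO.numParams s₀ M L K : ℝ) ≤ (s₀ : ℝ) ^ 2 * n →
      -- clients: covariate domain, covariate laws, true regression functions
      ∀ N : ℕ, 1 ≤ N → ∀ S : Set (Fin s₀ → ℝ), (∀ x ∈ S, ∀ k, |x k| ≤ R) →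
      ∀ μ : Fin N → Measure (Fin s₀ → ℝ), (∀ i, IsProbabilityMeasure (μ i)) →
      (∀ i, ∀ᵐ x ∂(μ i), x ∈ S) →
      ∀ f : Fin N → (Fin s₀ → ℝ) → Fin K → ℝ, (∀ i, Measurable (f i)) →
      -- joint law of the data sets of all clients
      ∀ P : Measure (Fin N → FedELBO.Dataset s₀ K n),
      (∀ i, P.map (fun D => D i) = FedELBO.dataLaw n (μ i) (f i) s) →
      -- parameter sets of the prior and of the variational posteriors
      ∀ Θ Φ : Set (FedELBO.GaussParam (FedELBO.WeightIndex s₀ M L K)),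
      FedELBO.IsParamSet B Θ → FedELBO.IsParamSet B Φ →
      P {D | ¬ ∀ θ φ, FedELBO.IsOptimal σ B s Θ Φ D θ φ →
          ENNReal.ofReal ((N : ℝ)⁻¹ * ∑ i, ∫ w, FedELBO.hellingerSq s (μ i)
              (FedELBO.network σ w) (f i) ∂(FedELBO.weightLaw B (φ i))) ≤
            ENNReal.ofReal (C * FedELBO.epsRate δ s₀ M L K n ^ 2 +
                C' * FedELBO.rate s₀ M L K n) +
              ENNReal.ofReal C'' * ((N : ℝ≥0∞)⁻¹ *
                ∑ i, FedELBO.approxError M L σ B S (f i))}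
        ≤ ENNReal.ofReal η := by
  have hs0 : (0 : ℝ) < s := by exact_mod_cast hs
  set c₀ := Real.log (10 * (B + 2)) + 4 * Real.log (layerGrowth σ B R) + 7 with hc₀
  set c₁ := 2 * c₀ + 1 + (6 + 8 * B ^ 2 + 3) / (s : ℝ) ^ 2 with hc₁
  refine ⟨1, 1, 3 / (s : ℝ) ^ 2, one_pos, one_pos, by positivity, fun η hη => ?_⟩
  -- beyond this sample size `log n` exceeds the constants, including the `1 / η` of Markov's inequality
  obtain ⟨n₁, hn₁⟩ := exists_nat_ge (Real.exp (1 + (9 / 2 / η + c₁)))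
  refine ⟨n₁, fun n hn s₀ M L K hs₀ hM hL hK hd N hN S hSR μ hμ hμS f hf P hP Θ Φ hΘ hΦ => ?_⟩
  have hG1 : 1 ≤ layerGrowth σ B R := one_le_layerGrowth σ hB R
  have hc₀0 : 0 ≤ c₀ := by
    have h1 := Real.log_nonneg hG1
    have h2 : 0 ≤ Real.log (10 * (B + 2)) := Real.log_nonneg (by linarith)
    positivity
  have hc₁0 : 0 ≤ c₁ := by positivity
  have hlogn : 1 + (9 / 2 / η + c₁) ≤ Real.log n := by
    have h1 : Real.exp (1 + (9 / 2 / η + c₁)) ≤ n := hn₁.trans (by exact_mod_cast hn)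
    exact (Real.le_log_iff_exp_le ((Real.exp_pos _).trans_le h1)).2 h1
  have hη' : 0 < 9 / 2 / η := by positivity
  have hlog1 : 1 ≤ Real.log n := by linarith
  have hn1 : 1 ≤ n := by
    rcases Nat.eq_zero_or_pos n with h | h
    · rw [h] at hlog1; norm_num at hlog1
    · exact h
  have hn0 : (0 : ℝ) < n := by exact_mod_cast hn1
  have hN0 : (0 : ℝ) < N := by exact_mod_cast hN
  set d : ℝ := (numParams s₀ M L K : ℝ) with hddef
  have hKd : (K : ℝ) ≤ d := by
    rw [hddef, numParams_eq]
    exact_mod_cast (by nlinarith [Nat.zero_le ((L - 1) * (M * (M + 1)))] :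
      K ≤ M * (s₀ + 1) + ((L - 1) * (M * (M + 1)) + K * (M + 1)))
  have hd1 : 1 ≤ d := le_trans (by exact_mod_cast hK) hKd
  set ρ := rate s₀ M L K n with hρdef
  have hdρ : d ≤ n * ρ := numParams_le hM hL hK hn1 hd
  have hρ0 : 0 < ρ := by
    by_contra hcon
    have := mul_nonpos_of_nonneg_of_nonpos hn0.le (not_lt.1 hcon)
    linarith
  -- the logarithmic factor in the rate absorbs all constants
  have heps : ρ * ((9 / 2 / η + c₁) * Real.log n) ≤ epsRate δ s₀ M L K n ^ 2 := by
    have h1 : Real.log n ≤ Real.log n ^ δ := by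
      simpa using Real.rpow_le_rpow_of_exponent_le hlog1 hδ.le
    have h2 : epsRate δ s₀ M L K n ^ 2 = ρ * (Real.log n ^ δ) ^ 2 := by
      rw [epsRate, mul_pow, Real.sq_sqrt hρ0.le]
    rw [h2]
    refine mul_le_mul_of_nonneg_left ?_ hρ0.le
    calc (9 / 2 / η + c₁) * Real.log n ≤ Real.log n * Real.log n := by gcongr; linarith
      _ = Real.log n ^ 2 := (sq _).symm
      _ ≤ (Real.log n ^ δ) ^ 2 := by gcongr
  have heps0 : 0 ≤ epsRate δ s₀ M L K n ^ 2 := sq_nonneg _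
  rw [one_mul, one_mul]
  -- the Hellinger distance is at most one, so only small rates matter
  by_cases hbig : 1 ≤ ρ
  · refine le_trans (le_of_eq (measure_mono_null (fun D hD => ?_) measure_empty)) zero_le
    refine hD fun θ φ hopt => le_trans (ENNReal.ofReal_le_ofReal ?_) le_self_add
    have h1 : ∀ i, ∫ w, hellingerSq s (μ i) (network σ w) (f i) ∂(weightLaw B (φ i)) ≤ 1 := by
      intro i
      have := hμ i
      have := isProbabilityMeasure_weightLaw (hΦ.charges _ (hopt.2 i).1)
      calc _ ≤ ∫ _, (1 : ℝ) ∂(weightLaw B (φ i)) :=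
            integral_mono_of_nonneg (Filter.Eventually.of_forall fun w => hellingerSq_nonneg _ _ _ _)
              (integrable_const _) (Filter.Eventually.of_forall fun w => hellingerSq_le_one _ _ _ _)
        _ = 1 := by simp
    have h2 : (N : ℝ)⁻¹ * ∑ i, ∫ w, hellingerSq s (μ i) (network σ w) (f i) ∂(weightLaw B (φ i)) ≤
        1 := by
      calc _ ≤ (N : ℝ)⁻¹ * ∑ _i : Fin N, (1 : ℝ) := by gcongr with i; exact h1 i
        _ = 1 := by simp [hN0.ne']
    linarith
  rw [not_le] at hbig
  have hdn : d ≤ n := hdρ.trans (by nlinarith)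
  by_cases htop : ∃ i, approxError M L σ B S (f i) = ∞
  · -- an infinite approximation error makes the right-hand side infinite
    obtain ⟨i₀, hi₀⟩ := htop
    have hsum : ∑ i, approxError M L σ B S (f i) = ∞ := by
      rw [ENNReal.sum_eq_top]
      exact ⟨i₀, Finset.mem_univ _, hi₀⟩
    have hinf : ENNReal.ofReal (3 / (s : ℝ) ^ 2) * ((N : ℝ≥0∞)⁻¹ *
        ∑ i, approxError M L σ B S (f i)) = ∞ := by
      rw [hsum, ENNReal.mul_top (by simp), ENNReal.mul_top]
      simpa using by positivity
    refine le_trans (le_of_eq (measure_mono_null (fun D hD => ?_) measure_empty)) zero_le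
    refine hD fun θ φ hopt => ?_
    rw [hinf, add_top]
    exact le_top
  push Not at htop
  set ξ : Fin N → ℝ := fun i => (approxError M L σ B S (f i)).toReal with hξdef
  have hξ0 : ∀ i, 0 ≤ ξ i := fun i => ENNReal.toReal_nonneg
  choose w₀ hw₀ hw₀S using fun i => exists_near_optimal_weights (htop i) hρ0
  set Λ := networkLip σ B R s₀ M L K with hΛdef
  have hΛ : 1 ≤ Λ := one_le_networkLip σ hB R hs₀ (by omega) hK
  -- a cell of the grid has half-width `B / T ≤ 1 / (n Λ ^ 2)`, also the width of the posteriors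
  set T : ℕ := ⌈n * Λ ^ 2 * B⌉₊ + 1 with hTdef
  have hT : 1 ≤ T := by omega
  have hT1 : (1 : ℝ) ≤ T := by exact_mod_cast hT
  have hTn : n * Λ ^ 2 * B ≤ T := by
    rw [hTdef]; push_cast
    linarith [Nat.le_ceil (n * Λ ^ 2 * B)]
  have hT2 : (T : ℝ) ≤ n * Λ ^ 2 * B + 2 := by
    rw [hTdef]; push_cast
    linarith [Nat.ceil_lt_add_one (show 0 ≤ n * Λ ^ 2 * B by positivity)]
  have hentropy : d * Real.log (10 * T) ≤ n * ρ * (c₀ * Real.log n) :=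
    mul_log_resolution_le hB hs₀ hM hL hK hlog1 hd hdn hT1 hT2
  have hprob : ∀ i, IsProbabilityMeasure
      (weightLaw B (w₀ i, fun _ => Real.toNNReal (B / T) ^ 2)) := fun i =>
    isProbabilityMeasure_weightLaw (hΦ.charges _ (hΦ.isotropic_div_mem hB hT1 (hw₀ i)))
  have hclient := fun i => exists_deviation_bound (μ := μ i) (f := f i) (n := n)
    (continuous_network hσ.continuous) (hf i) hs hB hΛ hn1 hT hTn (hμS i)
    (fun w hw w' hw' r hr hd x hx =>
      sqDist_network_le hσ hB hr hs₀ (by omega) hL hw hw' hd (hSR x hx))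
    (hw₀ i) (add_nonneg (hξ0 i) hρ0.le) (hw₀S i)
  choose V hVm hV0 hVint hVbound using hclient
  have hgood : ∀ᵐ D ∂P, ∀ i m, (D i m).1 ∈ S := by
    rw [ae_all_iff]
    intro i
    have h1 := ae_dataLaw_mem (n := n) (s := s) (hf i) (hμS i)
    rw [← hP i] at h1
    exact ae_of_ae_map (measurable_pi_apply i).aemeasurable h1
  -- Markov's inequality for the sum over the clients
  set t : ℝ := N * (2 + K) / η with htdef
  have ht0 : 0 < t := by positivity
  have hmarkov : P {D | ENNReal.ofReal t ≤ ∑ i, ENNReal.ofReal (V i (D i))} ≤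
      ENNReal.ofReal η := by
    have hmeas : ∀ i, Measurable fun D : Fin N → Dataset s₀ K n => ENNReal.ofReal (V i (D i)) :=
      fun i => ((hVm i).comp (measurable_pi_apply i)).ennreal_ofReal
    refine (meas_ge_le_lintegral_div (Finset.measurable_sum _ fun i _ => hmeas i).aemeasurable
      (by simpa using ht0) ENNReal.ofReal_ne_top).trans ?_
    rw [lintegral_finsetSum _ fun i _ => hmeas i]
    have h1 : ∀ i, ∫⁻ D, ENNReal.ofReal (V i (D i)) ∂P ≤ ENNReal.ofReal (2 + K) := by
      intro i
      refine le_trans (le_of_eq ?_) (hVint i)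
      rw [← hP i, lintegral_map (hVm i).ennreal_ofReal (measurable_pi_apply i)]
    refine ENNReal.div_le_of_le_mul ?_
    calc _ ≤ ∑ _i : Fin N, ENNReal.ofReal (2 + K) := Finset.sum_le_sum fun i _ => h1 i
      _ = ENNReal.ofReal (N * (2 + K)) := by
          rw [Finset.sum_const, Finset.card_univ, Fintype.card_fin, nsmul_eq_mul,
            ENNReal.ofReal_mul (Nat.cast_nonneg _), ENNReal.ofReal_natCast]
      _ = ENNReal.ofReal η * ENNReal.ofReal t := by
          rw [← ENNReal.ofReal_mul hη.le, htdef]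
          congr 1
          field_simp
  refine le_trans (measure_mono_ae ?_) hmarkov
  filter_upwards [hgood] with D hD hfail
  by_contra hsmall
  refine hfail fun θ φ hopt => ?_
  have hVt : ∑ i, V i (D i) ≤ t := by
    replace hsmall : ¬ ENNReal.ofReal t ≤ ∑ i, ENNReal.ofReal (V i (D i)) := hsmall
    rw [not_le, ← ENNReal.ofReal_sum_of_nonneg fun i _ => hV0 i _] at hsmall
    exact ((ENNReal.ofReal_lt_ofReal_iff ht0).1 hsmall).le
  have hsum := sum_hellinger_le hσ.continuous hs hopt hΘ hΦ hN hB hT hw₀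
    (a := fun i => n * ∫ w, hellingerSq s (μ i) (network σ w) (f i) ∂(weightLaw B (φ i)))
    (V := fun i => V i (D i))
    (c := fun i => d * Real.log T + (2 + 2 * n * (ξ i + ρ) + 8 * B ^ 2) / (s : ℝ) ^ 2)
    (c' := fun i => (2 * n * (ξ i + ρ) + 8 * d) / (s : ℝ) ^ 2)
    (fun i => ((hVbound i (D i) (hD i)).1 (φ i)
      (isProbabilityMeasure_weightLaw (hΦ.charges _ (hopt.2 i).1))).trans_eq (by
        rw [add_assoc _ (_ * _)]; rfl))
    (fun i => (hVbound i (D i) (hD i)).2)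
  rw [← Finset.mul_sum] at hsum
  set H := ∑ i, ∫ w, hellingerSq s (μ i) (network σ w) (f i) ∂(weightLaw B (φ i)) with hH
  have hTlog : d * Real.log T ≤ d * Real.log (10 * T) := by
    gcongr
    linarith
  have havg := average_le_of_sum_le hN0 hn0 hρ0 hlog1 hd1 hdρ hKd hTlog hentropy hc₀0
    (by positivity : (0 : ℝ) < (s : ℝ) ^ 2) hη hVt hsum
  have hfinal : (N : ℝ)⁻¹ * H ≤ epsRate δ s₀ M L K n ^ 2 + ρ +
      3 / (s : ℝ) ^ 2 * ((N : ℝ)⁻¹ * ∑ i, ξ i) := by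
    linarith
  have hξsum : 0 ≤ (N : ℝ)⁻¹ * ∑ i, ξ i :=
    mul_nonneg (inv_pos.2 hN0).le (Finset.sum_nonneg fun i _ => hξ0 i)
  refine (ENNReal.ofReal_le_ofReal hfinal).trans (le_of_eq ?_)
  rw [ENNReal.ofReal_add (by positivity) (by positivity), ENNReal.ofReal_mul (by positivity),
    ENNReal.ofReal_mul (inv_pos.2 hN0).le, ENNReal.ofReal_inv_of_pos hN0, ENNReal.ofReal_natCast,
    ENNReal.ofReal_sum_of_nonneg fun i _ => hξ0 i]
  simp only [hξdef, ENNReal.ofReal_toReal (htop _)]
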